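/- **Setting.** Let $\mathcal X\subseteq\mathbb R^m$ be the data space and $\Theta\subseteq\mathbb R^p$ a parameter set, $\rho:\mathcal X\times\mathbb R^p\to\mathbb R$ a loss and $\Psi:\mathcal X\times\mathbb R^p\to\mathbb R^p$ a score with $\Psi(x,\theta)=\nabla_\theta\rho(x,\theta)$ for $\theta\in\Theta$. For a data set $x_{1:n}\in\mathcal X^n$ put $\mathcal L_n(\theta)=\frac1n\sum_{i=1}^n\rho(x_i,\theta)$, so that $\nabla\mathcal L_n(\theta)=\frac1n\sum_{i=1}^n\Psi(x_i,\theta)$ on $\Theta$. Given $\eta,B,\mu>0$, an integer $K\ge1$ and a fixed (data-independent) start $\theta^{(0)}$, noisy gradient descent is $$\theta^{(k+1)}=\theta^{(k)}-\frac{\eta}{n}\sum_{i=1}^n\Psi(x_i,\theta^{(k)})+\frac{2\eta B\sqrt K}{\mu n}Z_k,\qquad 0\le k<K,$$ with $Z_0,\dots,Z_{K-1}$ i.i.d. standard Gaussian vectors in $\mathbb R^p$; its output is $\theta^{(K)}$. A random function $h$ of the data set is $f$-DP, where $f$ is convex, continuous and non-increasing on $[0,1]$ with $f(\alpha)\le1-\alpha$,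 if for all data sets $x_{1:n},x'_{1:n}$ that differ in exactly one record, and all $\alpha\in[0,1]$, every level-$\alpha$ test of the law of $h(x_{1:n})$ against the law of $h(x'_{1:n})$ has power at most $1-f(\alpha)$; $h$ is $\mu$-GDP if it is $f$-DP for some such $f$ with $f(\alpha)\ge\Phi(\Phi^{-1}(1-\alpha)-\mu)$ on $[0,1]$, $\Phi$ being the standard normal distribution function. $\mathcal B_r(\theta)$ is the closed Euclidean ball. **Theorem.** (i) Let $n\ge 1$. If $\|\Psi(x,\theta)\|_2\le B$ for all $x\in\mathcal X$ and $\theta\in\mathbb R^p$, and $\Psi(x,\cdot)$ is measurable for every $x$, then the random function $x_{1:n}\mapsto\theta^{(K)}$ on $\mathcal X^n$ is $\mu$-GDP. (ii) Let $\tau_1,\tau_2>0$ and $0<\eta\le\frac12\min\{1/\tau_2,1\}$. There are a constant $C>0$ depending only on $\tau_1,\tau_2,\eta$, constants $c_1(p,r,B)>0$ depending only on $\tau_1,\tau_2,\eta,p,r,B$, and constants $c_2(M)>0$ depending only on $\tau_1,\tau_2,\eta,M$, with the following property. Let $r>0$, $0<\mu\le M$, $\xi\in(0,1)$, $n\ge2$,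 $K\ge1$, $\theta_0\in\mathbb R^p$ with $\mathcal B_r(\theta_0)\subseteq\Theta$, $\|\Psi(x,\theta)\|_2\le B$ on $\mathcal X\times\Theta$, and let $x_{1:n}\in\mathcal X^n$ be such that $\mathcal L_n$ is convex on the convex set $\Theta$, $$\mathcal L_n(\theta_1)-\mathcal L_n(\theta_2)\ge\langle\nabla\mathcal L_n(\theta_2),\theta_1-\theta_2\rangle+\tau_1\|\theta_1-\theta_2\|_2^2\quad\forall\,\theta_1,\theta_2\in\mathcal B_r(\theta_0),$$ $$\mathcal L_n(\theta_1)-\mathcal L_n(\theta_2)\le\langle\nabla\mathcal L_n(\theta_2),\theta_1-\theta_2\rangle+\tau_2\|\theta_1-\theta_2\|_2^2\quad\forall\,\theta_1,\theta_2\in\Theta.$$ Let $\hat\theta$ be a minimizer of $\mathcal L_n$ over $\Theta$ with $\hat\theta\in\mathcal B_{r/2}(\theta_0)$, and let $\theta^{(0)}\in\Theta$ satisfy $\mathcal L_n(\theta^{(0)})-\mathcal L_n(\hat\theta)\le\frac{r^2}{4}\tau_1$. If $$n\ge c_1(p,r,B)\,\frac{\sqrt{K\log(K/\xi)}}{\mu}\qquad\text{and}\qquad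 K\ge c_2(M)\log n,$$ then, with probability at least $1-\xi$ over the noise, $$\|\theta^{(K)}-\hat\theta\|_2\le C\,\frac{B\sqrt K\,(\sqrt p+\sqrt{2\log(K/\xi)})}{\mu n}.$$ -/

import Mathlib

open MeasureTheory ProbabilityTheory

noncomputable section

/-- `ℝᵈ` with the Euclidean norm. -/
abbrev Eucl (d : ℕ) : Type := EuclideanSpace ℝ (Fin d)

/-- The standard normal cumulative distribution function `Φ`. -/
def stdNormalCDF (t : ℝ) : ℝ := cdf (gaussianReal 0 1) t

/-- The standard normal quantile function `Φ⁻¹` (meaningful for `0 < u < 1`). -/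
def stdNormalQuantile (u : ℝ) : ℝ := sInf {t : ℝ | u ≤ stdNormalCDF t}

/-- The function `α ↦ Φ(Φ⁻¹(1 - α) - μ)` on `[0, 1]`, with the conventions
`Φ⁻¹(1) = ∞`, `Φ⁻¹(0) = -∞`, `Φ(∞) = 1`, `Φ(-∞) = 0` at the two endpoints. -/
def gaussianTradeoff (μ α : ℝ) : ℝ :=
  if α ≤ 0 then 1
  else if 1 ≤ α then 0
  else stdNormalCDF (stdNormalQuantile (1 - α) - μ)

/-- Two data sets with `n` records are neighbours: their Hamming distance equals one. -/
def Neighbours {𝒳 : Type*} {n : ℕ} (x x' : Fin n → 𝒳) : Prop :=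
  {i : Fin n | x i ≠ x' i}.ncard = 1

/-- A (possibly randomized) test: a measurable function with values in `[0, 1]`, the value being
the probability of rejecting the null hypothesis. -/
def IsTest {Y : Type*} [MeasurableSpace Y] (φ : Y → ℝ) : Prop :=
  Measurable φ ∧ ∀ y, φ y ∈ Set.Icc (0 : ℝ) 1

/-- `f`-differential privacy of a random function `h`, given through the law `h x` of its output
on the data set `x`: any test of level `α` between the output laws on two neighbouring data sets
has power at most `1 - f α`. -/
structure IsFDP {𝒳 Y : Type*} [MeasurableSpace Y] {n : ℕ} (f : ℝ → ℝ)
    (h : (Fin n → 𝒳) → Measure Y) : Prop where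
  convexOn : ConvexOn ℝ (Set.Icc 0 1) f
  continuousOn : ContinuousOn f (Set.Icc 0 1)
  antitoneOn : AntitoneOn f (Set.Icc 0 1)
  le_one_sub : ∀ α ∈ Set.Icc (0 : ℝ) 1, f α ≤ 1 - α
  isProbabilityMeasure : ∀ x, IsProbabilityMeasure (h x)
  power_le : ∀ x x' : Fin n → 𝒳, Neighbours x x' →
    ∀ α ∈ Set.Icc (0 : ℝ) 1, ∀ φ : Y → ℝ, IsTest φ →
      ∫ y, φ y ∂(h x) ≤ α → ∫ y, φ y ∂(h x') ≤ 1 - f α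

/-- `μ`-Gaussian differential privacy. -/
def IsGDP {𝒳 Y : Type*} [MeasurableSpace Y] {n : ℕ} (μ : ℝ)
    (h : (Fin n → 𝒳) → Measure Y) : Prop :=
  ∃ f : ℝ → ℝ, IsFDP f h ∧ ∀ α ∈ Set.Icc (0 : ℝ) 1, gaussianTradeoff μ α ≤ f α

/-- The empirical loss `ℒₙ(θ) = (1/n) ∑ᵢ ρ(xᵢ, θ)`. -/
def empLoss {𝒳 : Type*} {n p : ℕ} (ρ : 𝒳 → Eucl p → ℝ) (x : Fin n → 𝒳) (θ : Eucl p) : ℝ :=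
  (1 / (n : ℝ)) * ∑ i, ρ (x i) θ

/-- The empirical mean `(1/n) ∑ᵢ Ψ(xᵢ, θ)` of the score; it is `∇ℒₙ(θ)` when `Ψ = ∂ρ/∂θ`. -/
def empScore {𝒳 : Type*} {n p : ℕ} (Ψ : 𝒳 → Eucl p → Eucl p) (x : Fin n → 𝒳)
    (θ : Eucl p) : Eucl p :=
  (1 / (n : ℝ)) • ∑ i, Ψ (x i) θ

/-- The function `L` with gradient `g` is `τ`-strongly convex on `S`. -/
def IsStronglyConvexOn {p : ℕ} (τ : ℝ) (S : Set (Eucl p)) (L : Eucl p → ℝ)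
    (g : Eucl p → Eucl p) : Prop :=
  ∀ θ₁ ∈ S, ∀ θ₂ ∈ S, L θ₁ - L θ₂ ≥ inner ℝ (g θ₂) (θ₁ - θ₂) + τ * ‖θ₁ - θ₂‖ ^ 2

/-- The function `L` with gradient `g` is `τ`-smooth on `S`. -/
def IsSmoothOn {p : ℕ} (τ : ℝ) (S : Set (Eucl p)) (L : Eucl p → ℝ)
    (g : Eucl p → Eucl p) : Prop :=
  ∀ θ₁ ∈ S, ∀ θ₂ ∈ S, L θ₁ - L θ₂ ≤ inner ℝ (g θ₂) (θ₁ - θ₂) + τ * ‖θ₁ - θ₂‖ ^ 2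

/-- The noisy gradient descent iterates `θ⁽ᵏ⁾` tuned for `K` iterations, run with noise vectors
`z 0, z 1, …`:
`θ⁽ᵏ⁺¹⁾ = θ⁽ᵏ⁾ - (η/n) ∑ᵢ Ψ(xᵢ, θ⁽ᵏ⁾) + (2ηB√K / (μn)) zₖ`. -/
def ngd {𝒳 : Type*} {n p : ℕ} (Ψ : 𝒳 → Eucl p → Eucl p) (η B μ : ℝ) (K : ℕ)
    (θinit : Eucl p) (z : ℕ → Eucl p) (x : Fin n → 𝒳) : ℕ → Eucl p
  | 0 => θinit
  | k + 1 =>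
      ngd Ψ η B μ K θinit z x k - η • empScore Ψ x (ngd Ψ η B μ K θinit z x k)
        + (2 * η * B * √(K : ℝ) / (μ * n)) • z k

/-- `Z 0, …, Z (K - 1)` are i.i.d. standard Gaussian random vectors in `ℝᵖ`. -/
structure IsGaussianNoise {Ω : Type*} [MeasurableSpace Ω] {p : ℕ} (P : Measure Ω) (K : ℕ)
    (Z : ℕ → Ω → Eucl p) : Prop where
  hasLaw : ∀ k < K, HasLaw (Z k) (stdGaussian (Eucl p)) P
  indep : iIndepFun (fun k : Fin K => Z k) P

end

open Filter Topology
open scoped NNReal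

noncomputable section

/-! Privacy. For a variance `v`, let `H_v(c) = E max(e^(X - v/2) - c, 0)` with `X ~ N(0, v)`. If a
test of level `a` and power `b` satisfies `b - c a ≤ H_v(c)` for every real `c`, with `v = μ²`, then
its power obeys the Gaussian trade-off bound, because `α ↦ Φ(Φ⁻¹(1 - α) - μ)` is the envelope of the
supporting lines encoded by `H_v` (`power_le_of_hockeyStick_le`). So this function itself serves as
`f`. Hockey-stick bounds compose without loss. A test is pulled back through the remaining steps by
the Markov operator `gaussianStep`. By Cameron–Martin, replacing one drift by the other reweights a
step by a likelihood ratio `e`. Since `e u - c w = e (u - (c / e) w)`, the bound for the remaining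
steps at level `c / e` integrates to a bound in which the variances add (`gaussianStep_sub_le`).
Changing one record moves the noiseless update by at most `2ηB/n`, which is `μ/√K` noise standard
deviations, so `K` steps accumulate variance `μ²`.

Convergence. By Gaussian concentration and a union bound, all noise vectors have norm at most `√p +
√(2 log(K/ξ))` with probability at least `1 - ξ`; the rest is deterministic. Within distance `r/2`
of the minimizer a gradient step contracts by `κ = e^(-ητ₁)` (`norm_gradient_step_le`), the start
lies in this region (`norm_sub_le_of_excess_le`), and the lower bound on `n` keeps the noise below
the margin `(1 - κ) r/2`, so the iterates never leave it. The error is then at most `κ^K r/2` plus a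
geometric series of noise. The first term is of the order of the second, because the lower bound on
`K` gives `κ^K ≤ 1/(μn)` and strong convexity with bounded gradients gives `τ₁ r ≤ B`. -/

/-! ### Gaussian measures: Cameron–Martin formula and norm concentration. -/

open Complex in
theorem integral_exp_mul_cexp_gaussianReal (v t : ℝ) :
    ∫ x, cexp ((v + t * I) * x) ∂(gaussianReal 0 1) = cexp ((v + t * I) ^ 2 / 2) := by
  have := complexMGF_id_gaussianReal (μ := 0) (v := 1) ((v : ℂ) + t * I)
  simpa [complexMGF] using this

theorem integrable_exp_inner_stdGaussian {p : ℕ} (v : Eucl p) (a : ℝ) :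
    Integrable (fun z => Real.exp (inner ℝ v z - a)) (stdGaussian (Eucl p)) := by
  rw [← map_pi_eq_stdGaussian, integrable_map_measure (by fun_prop) (by fun_prop)]
  have : ((fun z : Eucl p => Real.exp (inner ℝ v z - a)) ∘ WithLp.toLp 2) =
      fun x : Fin p → ℝ => (∏ i, Real.exp (v i * x i)) * Real.exp (-a) := by
    ext x
    simp [PiLp.inner_apply, ← Real.exp_sum, ← Real.exp_add, sub_eq_add_neg, mul_comm, add_comm]
  rw [this]
  exact (Integrable.fintype_prod fun i => integrable_exp_mul_gaussianReal (v i)).mul_const _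

-- The integrand factors over coordinates, so this reduces to the one-dimensional complex moment
-- generating function; it identifies the exponentially tilted Gaussian as a translate.
open Complex in
theorem charFun_withDensity_stdGaussian {p : ℕ} (v t : Eucl p) :
    ∫ z, (Real.exp (inner ℝ v z - ‖v‖ ^ 2 / 2)) • cexp (inner ℝ z t * I) ∂(stdGaussian (Eucl p)) =
      cexp (- ‖t‖ ^ 2 / 2) * cexp (inner ℝ v t * I) := by
  rw [← map_pi_eq_stdGaussian, integral_map (by fun_prop) (by fun_prop)]
  have : (fun x : Fin p → ℝ => (Real.exp (inner ℝ v (WithLp.toLp 2 x) - ‖v‖ ^ 2 / 2)) •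
      cexp (inner ℝ (WithLp.toLp 2 x : Eucl p) t * I)) =
      fun x : Fin p → ℝ => (∏ i, cexp ((v i + t i * I) * x i)) * cexp (- ‖v‖ ^ 2 / 2) := by
    ext x
    simp only [PiLp.inner_apply, RCLike.inner_apply, conj_trivial, real_smul, ofReal_exp,
      ← Complex.exp_sum, ← Complex.exp_add]
    congr 1
    push_cast
    rw [Finset.sum_mul, sub_eq_add_neg, add_right_comm, ← Finset.sum_add_distrib, neg_div]
    congr 1
    exact Finset.sum_congr rfl fun i _ => by ring
  rw [this, integral_mul_const, integral_fintype_prod_eq_prod (𝕜 := ℂ)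
    (f := fun i (x : ℝ) => cexp ((v i + t i * I) * x))]
  simp_rw [integral_exp_mul_cexp_gaussianReal]
  rw [← Complex.exp_sum, ← Complex.exp_add, ← Complex.exp_add]
  congr 1
  simp only [← ofReal_pow, EuclideanSpace.real_norm_sq_eq, PiLp.inner_apply, RCLike.inner_apply,
    conj_trivial]
  push_cast
  simp only [neg_div, Finset.sum_div, Finset.sum_mul, ← Finset.sum_neg_distrib,
    ← Finset.sum_add_distrib]
  refine Finset.sum_congr rfl fun i _ => ?_
  linear_combination ((t i : ℂ) ^ 2 / 2) * I_sq

/-- The Cameron–Martin formula for the standard Gaussian measure. -/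
theorem stdGaussian_map_add_const {p : ℕ} (v : Eucl p) :
    (stdGaussian (Eucl p)).map (· + v) = (stdGaussian (Eucl p)).withDensity
      (fun z => ENNReal.ofReal (Real.exp (inner ℝ v z - ‖v‖ ^ 2 / 2))) := by
  have hfin : IsFiniteMeasure ((stdGaussian (Eucl p)).withDensity
      (fun z => ENNReal.ofReal (Real.exp (inner ℝ v z - ‖v‖ ^ 2 / 2)))) :=
    isFiniteMeasure_withDensity_ofReal (integrable_exp_inner_stdGaussian v _).2
  have : IsProbabilityMeasure ((stdGaussian (Eucl p)).map (· + v)) :=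
    Measure.isProbabilityMeasure_map (by fun_prop)
  apply Measure.ext_of_charFun
  ext t
  rw [charFun_map_add_const, charFun_stdGaussian, charFun_apply,
    integral_withDensity_eq_integral_toReal_smul (by fun_prop) (by simp)]
  simp_rw [ENNReal.toReal_ofReal (Real.exp_pos _).le]
  rw [charFun_withDensity_stdGaussian]

theorem integral_stdGaussian_add_const {p : ℕ} (v : Eucl p) {f : Eucl p → ℝ} (hf : Measurable f) :
    ∫ z, f (z + v) ∂(stdGaussian (Eucl p)) =
      ∫ z, Real.exp (inner ℝ v z - ‖v‖ ^ 2 / 2) * f z ∂(stdGaussian (Eucl p)) := by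
  rw [← integral_map (φ := (· + v)) (by fun_prop) hf.aestronglyMeasurable,
    stdGaussian_map_add_const,
    integral_withDensity_eq_integral_toReal_smul (by fun_prop) (by simp)]
  simp_rw [ENNReal.toReal_ofReal (Real.exp_pos _).le, smul_eq_mul]

theorem stdGaussian_map_inner {p : ℕ} (v : Eucl p) :
    (stdGaussian (Eucl p)).map (fun z => inner ℝ v z) = gaussianReal 0 (‖v‖₊ ^ 2) := by
  have := IsGaussian.map_eq_gaussianReal (μ := stdGaussian (Eucl p)) (innerSL ℝ v)
  rw [variance_dual_stdGaussian, integral_strongDual_stdGaussian] at this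
  simp only [innerSL_apply_norm, coe_innerSL_apply] at this
  rw [this]
  congr 1
  ext
  simp

theorem integral_exp_mul_sq_gaussianReal {l : ℝ} (hl : l < 1 / 2) :
    Integrable (fun x => Real.exp (l * x ^ 2)) (gaussianReal 0 1) ∧
    ∫ x, Real.exp (l * x ^ 2) ∂(gaussianReal 0 1) = (√(1 - 2 * l))⁻¹ := by
  have hb : 0 < 1 / 2 - l := by linarith
  have key : ∀ x : ℝ, gaussianPDFReal 0 1 x * Real.exp (l * x ^ 2) =
      (√(2 * Real.pi))⁻¹ * Real.exp (-(1 / 2 - l) * x ^ 2) := by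
    intro x
    simp only [gaussianPDFReal, NNReal.coe_one, mul_one, sub_zero]
    rw [mul_assoc, ← Real.exp_add]
    congr 2
    ring
  constructor
  · rw [gaussianReal_of_var_ne_zero 0 one_ne_zero,
      integrable_withDensity_iff_integrable_smul' (by fun_prop) (by simp [gaussianPDF])]
    simp_rw [toReal_gaussianPDF, smul_eq_mul, key]
    exact (integrable_exp_neg_mul_sq hb).const_mul _
  · rw [integral_gaussianReal_eq_integral_smul one_ne_zero]
    simp_rw [smul_eq_mul, key]
    rw [integral_const_mul, integral_gaussian, ← Real.sqrt_inv, ← Real.sqrt_mul (by positivity),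
      ← Real.sqrt_inv]
    congr 1
    have : 1 - 2 * l ≠ 0 := by linarith
    field_simp

/-- The exponential moments of a chi-squared variable. -/
theorem integral_exp_mul_norm_sq_stdGaussian {p : ℕ} {l : ℝ} (hl : l < 1 / 2) :
    Integrable (fun z => Real.exp (l * ‖z‖ ^ 2)) (stdGaussian (Eucl p)) ∧
    ∫ z, Real.exp (l * ‖z‖ ^ 2) ∂(stdGaussian (Eucl p)) = (√(1 - 2 * l))⁻¹ ^ p := by
  have : ∀ x : Fin p → ℝ, Real.exp (l * ‖(WithLp.toLp 2 x : Eucl p)‖ ^ 2) =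
      ∏ i, Real.exp (l * x i ^ 2) := by
    intro x
    simp [EuclideanSpace.real_norm_sq_eq, ← Real.exp_sum, Finset.mul_sum]
  constructor
  · rw [← map_pi_eq_stdGaussian, integrable_map_measure (by fun_prop) (by fun_prop)]
    refine Integrable.congr (Integrable.fintype_prod fun i =>
      (integral_exp_mul_sq_gaussianReal hl).1) (Filter.Eventually.of_forall fun x => (this x).symm)
  · rw [← map_pi_eq_stdGaussian, integral_map (by fun_prop) (by fun_prop)]
    simp_rw [this]
    rw [integral_fintype_prod_eq_prod (𝕜 := ℝ) (f := fun _ x => Real.exp (l * x ^ 2))]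
    simp [(integral_exp_mul_sq_gaussianReal hl).2]

/-- Gaussian concentration of the Euclidean norm. -/
theorem stdGaussian_norm_gt_le {p : ℕ} {t : ℝ} (ht : 0 ≤ t) :
    (stdGaussian (Eucl p)).real {z | √p + t < ‖z‖} ≤ Real.exp (-(t ^ 2 / 2)) := by
  rcases Nat.eq_zero_or_pos p with rfl | hp
  -- Dimension zero is separate because the Chernoff parameter below divides by `√p`.
  · have : {z : Eucl 0 | √((0 : ℕ) : ℝ) + t < ‖z‖} = ∅ := by
      ext z
      simp [Subsingleton.elim z 0, ht]
    rw [this]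
    simp [Real.exp_nonneg]
  set s := √(p : ℝ) with hs
  have hs0 : 0 < s := Real.sqrt_pos.2 (by exact_mod_cast hp)
  have hsq : s ^ 2 = p := Real.sq_sqrt (by positivity)
  -- The Chernoff exponent `l` minimizing `(1 - 2l)^(-p/2) e^(-l (s + t)²)` satisfies `1 - 2l = q²`.
  set q := s / (s + t) with hq
  have hq0 : 0 < q := by positivity
  set l := (1 - q ^ 2) / 2 with hldef
  have hl : l < 1 / 2 := by rw [hldef]; nlinarith [pow_pos hq0 2]
  have hl0 : 0 ≤ l := by
    have : q ≤ 1 := by rw [hq, div_le_one (by positivity)]; linarith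
    rw [hldef]; nlinarith
  obtain ⟨hint, hval⟩ := integral_exp_mul_norm_sq_stdGaussian (p := p) hl
  have hm := mul_meas_ge_le_integral_of_nonneg
    (Filter.Eventually.of_forall fun z : Eucl p => (Real.exp_pos (l * ‖z‖ ^ 2)).le) hint
    (Real.exp (l * (s + t) ^ 2))
  have hsub : (stdGaussian (Eucl p)).real {z | s + t < ‖z‖} ≤
      (stdGaussian (Eucl p)).real {z | Real.exp (l * (s + t) ^ 2) ≤ Real.exp (l * ‖z‖ ^ 2)} := by
    refine measureReal_mono fun z hz => ?_
    simp only [Set.mem_ofPred_eq, Real.exp_le_exp] at hz ⊢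
    gcongr
  have h1 : √(1 - 2 * l) = q := by
    rw [show 1 - 2 * l = q ^ 2 by rw [hldef]; ring, Real.sqrt_sq hq0.le]
  rw [hval, h1] at hm
  have h2 : q⁻¹ ^ p ≤ Real.exp (t * s) := by
    have : q⁻¹ ≤ Real.exp (t / s) := by
      rw [hq, inv_div, add_div, div_self hs0.ne']
      linarith [Real.add_one_le_exp (t / s)]
    calc q⁻¹ ^ p ≤ Real.exp (t / s) ^ p := by gcongr
      _ = Real.exp (t * s) := by
        rw [← Real.exp_nat_mul, ← hsq]
        congr 1
        field_simp
  have h3 : l * (s + t) ^ 2 = t * s + t ^ 2 / 2 := by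
    rw [hldef, hq]
    field_simp
    ring
  rw [h3] at hm hsub
  refine hsub.trans (le_of_mul_le_mul_left (hm.trans h2 |>.trans_eq ?_)
    (Real.exp_pos (t * s + t ^ 2 / 2)))
  rw [← Real.exp_add]
  congr 1
  ring

/-! ### Hockey-stick divergences between Gaussians. -/

/-- The hockey-stick divergence at level `c` of two Gaussians whose log-likelihood ratio has
variance `v`. -/
def gaussianHockeyStick (v : ℝ≥0) (c : ℝ) : ℝ :=
  ∫ x, max (Real.exp (x - v / 2) - c) 0 ∂(gaussianReal 0 v)

theorem integrable_exp_sub_gaussianReal (v : ℝ≥0) (a : ℝ) :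
    Integrable (fun x => Real.exp (x - a)) (gaussianReal 0 v) := by
  have := (integrable_exp_mul_gaussianReal (μ := 0) (v := v) 1).mul_const (Real.exp (-a))
  simpa [← Real.exp_add, sub_eq_add_neg] using this

theorem integral_exp_sub_gaussianReal (v : ℝ≥0) :
    ∫ x, Real.exp (x - v / 2) ∂(gaussianReal 0 v) = 1 := by
  have := congrFun (mgf_fun_id_gaussianReal (μ := 0) (v := v)) 1
  simp only [mgf, one_mul, zero_add, one_pow, mul_one] at this
  simp_rw [Real.exp_sub]
  rw [integral_div, this, div_self (Real.exp_pos _).ne']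

theorem gaussianHockeyStick_zero (c : ℝ) : gaussianHockeyStick 0 c = max (1 - c) 0 := by
  simp [gaussianHockeyStick, gaussianReal_zero_var]

theorem integrable_hockeyStick_prod (v₁ v₂ : ℝ≥0) (c : ℝ) :
    Integrable (fun z : ℝ × ℝ => max (Real.exp (z.1 - v₁ / 2) * Real.exp (z.2 - v₂ / 2) - c) 0)
      ((gaussianReal 0 v₁).prod (gaussianReal 0 v₂)) := by
  refine Integrable.sup ((Integrable.mul_prod (integrable_exp_sub_gaussianReal v₁ _)
    (integrable_exp_sub_gaussianReal v₂ _)).sub (integrable_const c)) (integrable_const 0)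

/-- A centred Gaussian of variance `v₁ + v₂` is a sum of independent ones; this is the source of
additivity of variances under composition. -/
theorem gaussianHockeyStick_add (v₁ v₂ : ℝ≥0) (c : ℝ) :
    gaussianHockeyStick (v₁ + v₂) c =
      ∫ x, ∫ y, max (Real.exp (x - v₁ / 2) * Real.exp (y - v₂ / 2) - c) 0
        ∂(gaussianReal 0 v₂) ∂(gaussianReal 0 v₁) := by
  have hconv : gaussianReal 0 v₁ ∗ gaussianReal 0 v₂ = gaussianReal 0 (v₁ + v₂) := by
    simpa using gaussianReal_conv_gaussianReal (m₁ := 0) (m₂ := 0) (v₁ := v₁) (v₂ := v₂)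
  rw [gaussianHockeyStick, ← hconv, integral_conv]
  · refine integral_congr_ae (Eventually.of_forall fun x => integral_congr_ae
      (Eventually.of_forall fun y => ?_))
    simp only [← Real.exp_add, NNReal.coe_add]
    congr 3
    ring
  · rw [hconv]
    exact ((integrable_exp_sub_gaussianReal _ _).sub (integrable_const c)).sup (integrable_const 0)

/-- Jensen's inequality: the extra likelihood-ratio factor has mean one and `max (· - c) 0` is
convex. -/
theorem gaussianHockeyStick_mono {v w : ℝ≥0} (h : v ≤ w) (c : ℝ) :
    gaussianHockeyStick v c ≤ gaussianHockeyStick w c := by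
  obtain ⟨u, rfl⟩ := exists_add_of_le h
  rw [gaussianHockeyStick_add, gaussianHockeyStick]
  refine integral_mono (((integrable_exp_sub_gaussianReal _ _).sub (integrable_const c)).sup
    (integrable_const 0)) (integrable_hockeyStick_prod v u c).integral_prod_left fun x => ?_
  have hi : Integrable (fun y => Real.exp (x - v / 2) * Real.exp (y - u / 2) - c)
      (gaussianReal 0 u) :=
    ((integrable_exp_sub_gaussianReal _ _).const_mul _).sub (integrable_const c)
  refine max_le ?_ (integral_nonneg fun y => le_max_right _ _)
  calc Real.exp (x - v / 2) - c
      = ∫ y, (Real.exp (x - v / 2) * Real.exp (y - u / 2) - c) ∂(gaussianReal 0 u) := by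
        rw [integral_sub ((integrable_exp_sub_gaussianReal _ _).const_mul _) (integrable_const c),
          integral_const_mul, integral_exp_sub_gaussianReal]
        simp
    _ ≤ _ := integral_mono hi (hi.sup (integrable_const 0)) fun y => le_max_left _ _

/-! ### The Gaussian trade-off function and its supporting lines. -/

/-- A nondegenerate Gaussian has no atoms, so its distribution function has no jumps. -/
theorem continuous_stdNormalCDF : Continuous stdNormalCDF := by
  have := nullSingletonClass_gaussianReal (μ := 0) (v := 1) one_ne_zero
  rw [continuous_iff_continuousAt]
  intro t
  have hsing := StieltjesFunction.measure_singleton (cdf (gaussianReal 0 1)) t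
  rw [measure_cdf, measure_singleton, eq_comm, ENNReal.ofReal_eq_zero, sub_nonpos] at hsing
  have hmono := monotone_cdf (gaussianReal 0 1)
  exact hmono.continuousAt_iff_leftLim_eq_rightLim.2
    ((hmono.leftLim_le le_rfl).antisymm hsing |>.trans
      (StieltjesFunction.rightLim_eq _ t).symm)

theorem stdNormalCDF_mono : Monotone stdNormalCDF := monotone_cdf _

theorem stdNormalCDF_stdNormalQuantile {u : ℝ} (h0 : 0 < u) (h1 : u < 1) :
    stdNormalCDF (stdNormalQuantile u) = u := by
  obtain ⟨a, ha⟩ := ((tendsto_cdf_atBot (gaussianReal 0 1)).eventually (gt_mem_nhds h0)).exists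
  obtain ⟨b, hb⟩ := ((tendsto_cdf_atTop (gaussianReal 0 1)).eventually (lt_mem_nhds h1)).exists
  obtain ⟨t, ht⟩ : ∃ t, stdNormalCDF t = u :=
    mem_range_of_exists_le_of_exists_ge continuous_stdNormalCDF ⟨a, ha.le⟩ ⟨b, hb.le⟩
  have hbdd : BddBelow {t : ℝ | u ≤ stdNormalCDF t} :=
    ⟨a, fun s hs => le_of_not_gt fun hsa => (hs.trans (stdNormalCDF_mono hsa.le)).not_gt ha⟩
  refine le_antisymm ((stdNormalCDF_mono (csInf_le hbdd ht.ge)).trans_eq ht) ?_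
  exact (isClosed_le continuous_const continuous_stdNormalCDF).csInf_mem ⟨t, ht.ge⟩ hbdd

/-- The slope of the Neyman–Pearson supporting line with threshold `t`. -/
def likelihoodThreshold (μ t : ℝ) : ℝ := Real.exp (μ * t - μ ^ 2 / 2)

theorem integrable_likelihood (μ c : ℝ) :
    Integrable (fun x => Real.exp (μ * x - μ ^ 2 / 2) - c) (gaussianReal 0 1) := by
  have := (integrable_exp_mul_gaussianReal (μ := 0) (v := 1) μ).mul_const (Real.exp (-(μ ^ 2 / 2)))
  simp only [← Real.exp_add, ← sub_eq_add_neg] at this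
  exact this.sub (integrable_const c)

/-- Tilting `N(0, 1)` by `e^(μx - μ²/2)` gives `N(μ, 1)`: the two terms are the power and `c` times
the level of the test rejecting above `s`. -/
theorem setIntegral_Ioi_likelihood (μ s c : ℝ) :
    ∫ x in Set.Ioi s, (Real.exp (μ * x - μ ^ 2 / 2) - c) ∂(gaussianReal 0 1) =
      (1 - stdNormalCDF (s - μ)) - c * (1 - stdNormalCDF s) := by
  have hIoi : ∀ t, (gaussianReal 0 1).real (Set.Ioi t) = 1 - stdNormalCDF t := fun t => by
    rw [stdNormalCDF, cdf_eq_real, ← Set.compl_Iic, probReal_compl_eq_one_sub measurableSet_Iic]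
  have hshift : (gaussianReal μ 1).real (Set.Ioi s) = 1 - stdNormalCDF (s - μ) := by
    have h := gaussianReal_map_add_const (μ := 0) (v := 1) μ
    rw [zero_add] at h
    rw [← hIoi, ← h, map_measureReal_apply (by fun_prop) measurableSet_Ioi]
    simp
  have hpdf : ∀ x, gaussianPDFReal 0 1 x * Real.exp (μ * x - μ ^ 2 / 2) =
      gaussianPDFReal μ 1 x := by
    intro x
    simp only [gaussianPDFReal, NNReal.coe_one, mul_one]
    rw [mul_assoc, ← Real.exp_add]
    congr 2
    ring
  have hexp : ∫ x in Set.Ioi s, Real.exp (μ * x - μ ^ 2 / 2) ∂(gaussianReal 0 1) =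
      (gaussianReal μ 1).real (Set.Ioi s) := by
    rw [← integral_indicator_one measurableSet_Ioi, ← integral_indicator measurableSet_Ioi,
      integral_gaussianReal_eq_integral_smul one_ne_zero,
      integral_gaussianReal_eq_integral_smul one_ne_zero]
    congr 1
    ext x
    by_cases hx : s < x
    · simp [Set.indicator, hx, hpdf]
    · simp [Set.indicator, hx]
  have hi : Integrable (fun x => Real.exp (μ * x - μ ^ 2 / 2)) (gaussianReal 0 1) := by
    simpa using integrable_likelihood μ 0
  rw [integral_sub hi.integrableOn integrableOn_const, hexp, hshift, setIntegral_const,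
    hIoi, smul_eq_mul, mul_comm c]

theorem gaussianHockeyStick_sq (μ c : ℝ) :
    gaussianHockeyStick (Real.toNNReal (μ ^ 2)) c =
      ∫ x, max (Real.exp (μ * x - μ ^ 2 / 2) - c) 0 ∂(gaussianReal 0 1) := by
  have h := gaussianReal_map_const_mul (μ := 0) (v := 1) μ
  have hv : NNReal.mk (μ ^ 2) (sq_nonneg μ) * 1 = Real.toNNReal (μ ^ 2) := by
    rw [mul_one, ← Real.toNNReal_of_nonneg]
  rw [mul_zero, hv] at h
  rw [gaussianHockeyStick, ← h, integral_map (by fun_prop) (by fun_prop),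
    Real.coe_toNNReal _ (sq_nonneg μ)]

/-- Since `μ > 0`, the likelihood ratio exceeds its value at `t` exactly on `(t, ∞)`, so the
positive part is the restriction to that half-line. -/
theorem gaussianHockeyStick_likelihoodThreshold {μ : ℝ} (hμ : 0 < μ) (t : ℝ) :
    gaussianHockeyStick (Real.toNNReal (μ ^ 2)) (likelihoodThreshold μ t) =
      (1 - stdNormalCDF (t - μ)) - likelihoodThreshold μ t * (1 - stdNormalCDF t) := by
  rw [gaussianHockeyStick_sq, ← setIntegral_Ioi_likelihood, ← integral_indicator measurableSet_Ioi]
  congr 1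
  ext x
  by_cases hx : t < x
  · rw [Set.indicator_of_mem (by exact hx), max_eq_left]
    rw [sub_nonneg, likelihoodThreshold]
    gcongr
  · rw [Set.indicator_of_notMem (by exact hx), max_eq_right]
    rw [sub_nonpos, likelihoodThreshold]
    have := not_lt.1 hx
    gcongr

theorem le_gaussianHockeyStick (μ s c : ℝ) :
    (1 - stdNormalCDF (s - μ)) - c * (1 - stdNormalCDF s) ≤
      gaussianHockeyStick (Real.toNNReal (μ ^ 2)) c := by
  rw [gaussianHockeyStick_sq, ← setIntegral_Ioi_likelihood]
  have hi := integrable_likelihood μ c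
  calc _ ≤ ∫ x in Set.Ioi s, max (Real.exp (μ * x - μ ^ 2 / 2) - c) 0 ∂(gaussianReal 0 1) :=
        integral_mono hi.integrableOn (hi.sup (integrable_const 0)).integrableOn
          fun x => le_max_left _ _
    _ ≤ _ := setIntegral_le_integral (hi.sup (integrable_const 0))
          (Eventually.of_forall fun x => le_max_right _ _)

theorem gaussianHockeyStick_nonneg (v : ℝ≥0) (c : ℝ) : 0 ≤ gaussianHockeyStick v c :=
  integral_nonneg fun _ => le_max_right _ _

theorem one_sub_le_gaussianHockeyStick (v : ℝ≥0) (c : ℝ) : 1 - c ≤ gaussianHockeyStick v c := by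
  have := gaussianHockeyStick_mono (zero_le (a := v)) c
  rw [gaussianHockeyStick_zero] at this
  exact (le_max_left _ _).trans this

theorem gaussianTradeoff_of_nonpos (μ : ℝ) {α : ℝ} (h : α ≤ 0) : gaussianTradeoff μ α = 1 :=
  if_pos h

theorem gaussianTradeoff_of_one_le (μ : ℝ) {α : ℝ} (h : 1 ≤ α) : gaussianTradeoff μ α = 0 := by
  rw [gaussianTradeoff, if_neg (by linarith), if_pos h]

/-- Every level in `(0, 1)` is the level of a threshold test. -/
theorem exists_gaussianTradeoff_eq (μ : ℝ) {α : ℝ} (h0 : 0 < α) (h1 : α < 1) :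
    ∃ t, stdNormalCDF t = 1 - α ∧ gaussianTradeoff μ α = stdNormalCDF (t - μ) := by
  refine ⟨stdNormalQuantile (1 - α),
    stdNormalCDF_stdNormalQuantile (by linarith) (by linarith), ?_⟩
  rw [gaussianTradeoff, if_neg h0.not_ge, if_neg h1.not_ge]

theorem stdNormalCDF_nonneg (t : ℝ) : 0 ≤ stdNormalCDF t := cdf_nonneg _ _

theorem stdNormalCDF_le_one (t : ℝ) : stdNormalCDF t ≤ 1 := cdf_le_one _ _

/-- The supporting line of the Gaussian trade-off function at the level `1 - Φ t`. -/
theorem supporting_line_le_gaussianTradeoff {μ : ℝ} (hμ : 0 < μ) (t : ℝ) {α : ℝ}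
    (hα : α ∈ Set.Icc (0 : ℝ) 1) :
    stdNormalCDF (t - μ) + likelihoodThreshold μ t * (1 - stdNormalCDF t - α) ≤
      gaussianTradeoff μ α := by
  -- With `c` the likelihood threshold at `t` and `G` the trade-off function, `heq` turns the claim
  -- into `1 - G α - c α ≤ H(c)`.
  have heq := gaussianHockeyStick_likelihoodThreshold hμ t
  rcases hα.1.eq_or_lt with rfl | h0
  · rw [gaussianTradeoff_of_nonpos μ le_rfl]
    have := gaussianHockeyStick_nonneg (Real.toNNReal (μ ^ 2)) (likelihoodThreshold μ t)
    linarith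
  rcases hα.2.eq_or_lt with rfl | h1
  · rw [gaussianTradeoff_of_one_le μ le_rfl]
    have := one_sub_le_gaussianHockeyStick (Real.toNNReal (μ ^ 2)) (likelihoodThreshold μ t)
    linarith
  obtain ⟨s, hs, hG⟩ := exists_gaussianTradeoff_eq μ h0 h1
  rw [hG]
  have := le_gaussianHockeyStick μ s (likelihoodThreshold μ t)
  rw [hs] at this
  linarith

theorem gaussianTradeoff_le_one_sub {μ : ℝ} (hμ : 0 < μ) {α : ℝ} (hα : α ∈ Set.Icc (0 : ℝ) 1) :
    gaussianTradeoff μ α ≤ 1 - α := by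
  rcases hα.1.eq_or_lt with rfl | h0
  · simp [gaussianTradeoff_of_nonpos]
  rcases hα.2.eq_or_lt with rfl | h1
  · simp [gaussianTradeoff_of_one_le]
  obtain ⟨s, hs, hG⟩ := exists_gaussianTradeoff_eq μ h0 h1
  rw [hG, ← hs]
  exact stdNormalCDF_mono (by linarith)

theorem gaussianTradeoff_nonneg (μ α : ℝ) : 0 ≤ gaussianTradeoff μ α := by
  unfold gaussianTradeoff
  split_ifs
  exacts [zero_le_one, le_rfl, stdNormalCDF_nonneg _]

theorem antitoneOn_gaussianTradeoff {μ : ℝ} (hμ : 0 < μ) :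
    AntitoneOn (gaussianTradeoff μ) (Set.Icc 0 1) := by
  intro a ha b hb hab
  rcases hb.2.eq_or_lt with rfl | h1
  · rw [gaussianTradeoff_of_one_le μ le_rfl]
    exact gaussianTradeoff_nonneg μ a
  rcases hb.1.eq_or_lt with rfl | h0
  · rw [le_antisymm hab ha.1]
  obtain ⟨t, ht, hG⟩ := exists_gaussianTradeoff_eq μ h0 h1
  refine le_trans ?_ (supporting_line_le_gaussianTradeoff hμ t ha)
  rw [hG, ht]
  have := mul_nonneg (Real.exp_pos (μ * t - μ ^ 2 / 2)).le (sub_nonneg.2 hab)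
  rw [likelihoodThreshold]
  linarith

/-- At an interior point some line lying below the whole graph touches it, which gives the convexity
inequality there. -/
theorem convexOn_gaussianTradeoff {μ : ℝ} (hμ : 0 < μ) :
    ConvexOn ℝ (Set.Icc 0 1) (gaussianTradeoff μ) := by
  rw [convexOn_iff_forall_pos]
  refine ⟨convex_Icc 0 1, fun x hx y hy a b ha hb hab => ?_⟩
  simp only [smul_eq_mul]
  have hz : a * x + b * y ∈ Set.Icc (0 : ℝ) 1 := convex_Icc 0 1 hx hy ha.le hb.le hab
  rcases hz.1.eq_or_lt with h0 | h0
  · have hx0 : x = 0 := by nlinarith [mul_nonneg ha.le hx.1, mul_nonneg hb.le hy.1, hx.1]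
    have hy0 : y = 0 := by nlinarith [mul_nonneg ha.le hx.1, mul_nonneg hb.le hy.1, hy.1]
    rw [← h0, hx0, hy0, ← add_mul, hab, one_mul]
  rcases hz.2.eq_or_lt with h1 | h1
  · rw [h1, gaussianTradeoff_of_one_le μ le_rfl]
    exact add_nonneg (mul_nonneg ha.le (gaussianTradeoff_nonneg _ _))
      (mul_nonneg hb.le (gaussianTradeoff_nonneg _ _))
  obtain ⟨t, ht, hG⟩ := exists_gaussianTradeoff_eq μ h0 h1
  have h2 := mul_le_mul_of_nonneg_left (supporting_line_le_gaussianTradeoff hμ t hx) ha.le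
  have h3 := mul_le_mul_of_nonneg_left (supporting_line_le_gaussianTradeoff hμ t hy) hb.le
  rw [hG]
  refine le_trans (le_of_eq ?_) (add_le_add h2 h3)
  rw [ht]
  obtain rfl : b = 1 - a := by linarith
  ring

theorem continuousOn_gaussianTradeoff {μ : ℝ} (hμ : 0 < μ) :
    ContinuousOn (gaussianTradeoff μ) (Set.Icc 0 1) := by
  intro α hα
  rcases hα.1.eq_or_lt with rfl | h0
  · rw [ContinuousWithinAt, gaussianTradeoff_of_nonpos μ le_rfl, tendsto_order]
    refine ⟨fun a ha => ?_, fun a ha => ?_⟩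
    -- Lower semicontinuity at `0`: the intercept of the supporting line at `t` is at least `Φ(t -
    -- μ)`, which tends to `1`.
    · have hlim : Tendsto (fun t => stdNormalCDF (t - μ)) atTop (𝓝 1) :=
        (tendsto_cdf_atTop _).comp (tendsto_atTop_add_const_right _ _ tendsto_id)
      obtain ⟨t, ht⟩ := (hlim.eventually (lt_mem_nhds ha)).exists
      have hc : ContinuousAt (fun α : ℝ => stdNormalCDF (t - μ) - likelihoodThreshold μ t * α) 0 :=
        by fun_prop
      have hev := hc.eventually (lt_mem_nhds (a := a) (by simpa using ht))
      filter_upwards [nhdsWithin_le_nhds hev, self_mem_nhdsWithin] with β hβ hβ'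
      refine hβ.trans_le (le_trans ?_ (supporting_line_le_gaussianTradeoff hμ t hβ'))
      have := mul_nonneg (Real.exp_pos (μ * t - μ ^ 2 / 2)).le
        (sub_nonneg.2 (stdNormalCDF_le_one t))
      rw [likelihoodThreshold]
      linarith
    · filter_upwards [self_mem_nhdsWithin] with β hβ
      linarith [gaussianTradeoff_le_one_sub hμ hβ, hβ.1]
  rcases hα.2.eq_or_lt with rfl | h1
  · rw [ContinuousWithinAt, gaussianTradeoff_of_one_le μ le_rfl]
    have hlim : Tendsto (fun α : ℝ => 1 - α) (𝓝[Set.Icc 0 1] 1) (𝓝 0) := by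
      have : ContinuousAt (fun α : ℝ => 1 - α) 1 := by fun_prop
      simpa using this.tendsto.mono_left nhdsWithin_le_nhds
    refine tendsto_of_tendsto_of_tendsto_of_le_of_le' tendsto_const_nhds hlim
      (Eventually.of_forall fun _ => gaussianTradeoff_nonneg _ _) ?_
    filter_upwards [self_mem_nhdsWithin] with β hβ using gaussianTradeoff_le_one_sub hμ hβ
  · have := (convexOn_gaussianTradeoff hμ).continuousOn_interior
    rw [interior_Icc] at this
    exact (this.continuousAt (Ioo_mem_nhds h0 h1)).continuousWithinAt

/-- Hockey-stick bounds at all Neyman–Pearson thresholds control the power of every test. -/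
theorem power_le_of_hockeyStick_le {μ : ℝ} (hμ : 0 < μ) {a b α : ℝ} (hα : α ∈ Set.Icc (0 : ℝ) 1)
    (hb : b ≤ 1) (hle : a ≤ α)
    (h : ∀ c, b - c * a ≤ gaussianHockeyStick (Real.toNNReal (μ ^ 2)) c) :
    b ≤ 1 - gaussianTradeoff μ α := by
  have key : ∀ t, b ≤ 1 - stdNormalCDF (t - μ) -
      likelihoodThreshold μ t * (1 - stdNormalCDF t - α) := by
    intro t
    have h1 := h (likelihoodThreshold μ t)
    rw [gaussianHockeyStick_likelihoodThreshold hμ] at h1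
    have h2 := mul_le_mul_of_nonneg_left hle (Real.exp_pos (μ * t - μ ^ 2 / 2)).le
    rw [likelihoodThreshold] at h1 ⊢
    linarith
  rcases hα.1.eq_or_lt with rfl | h0
  -- No finite threshold has level zero, so `t → ∞` is used instead.
  · rw [gaussianTradeoff_of_nonpos μ le_rfl]
    have hlim : Tendsto (fun t => 1 - stdNormalCDF (t - μ)) atTop (𝓝 (1 - 1)) :=
      tendsto_const_nhds.sub
        ((tendsto_cdf_atTop _).comp (tendsto_atTop_add_const_right _ _ tendsto_id))
    refine ge_of_tendsto' hlim fun t => (key t).trans ?_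
    have := mul_nonneg (Real.exp_pos (μ * t - μ ^ 2 / 2)).le
      (sub_nonneg.2 (stdNormalCDF_le_one t))
    rw [likelihoodThreshold]
    linarith
  rcases hα.2.eq_or_lt with rfl | h1
  · rwa [gaussianTradeoff_of_one_le μ le_rfl, sub_zero]
  obtain ⟨t, ht, hG⟩ := exists_gaussianTradeoff_eq μ h0 h1
  have := key t
  rw [ht] at this
  rw [hG]
  linarith

/-! ### Composition of Gaussian steps. -/

/-- The Markov operator of the Gaussian perturbation `y ↦ m y + σ z` acting on test functions. -/
def gaussianStep {p : ℕ} (m : Eucl p → Eucl p) (σ : ℝ) (φ : Eucl p → ℝ) (y : Eucl p) : ℝ :=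
  ∫ z, φ (m y + σ • z) ∂(stdGaussian (Eucl p))

theorem IsTest.integrable_comp {Y Ω : Type*} [MeasurableSpace Y] [MeasurableSpace Ω]
    {P : Measure Ω} [IsFiniteMeasure P] {φ : Y → ℝ} (hφ : IsTest φ) {X : Ω → Y}
    (hX : AEMeasurable X P) : Integrable (fun ω => φ (X ω)) P :=
  Integrable.of_bound (hφ.1.comp_aemeasurable hX).aestronglyMeasurable 1
    (Eventually.of_forall fun ω => by
      rw [Real.norm_of_nonneg (hφ.2 _).1]
      exact (hφ.2 _).2)

theorem IsTest.integral_mem_Icc {Y Ω : Type*} [MeasurableSpace Y] [MeasurableSpace Ω]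
    {P : Measure Ω} [IsProbabilityMeasure P] {φ : Y → ℝ} (hφ : IsTest φ) {X : Ω → Y}
    (hX : AEMeasurable X P) : ∫ ω, φ (X ω) ∂P ∈ Set.Icc (0 : ℝ) 1 := by
  refine ⟨integral_nonneg fun ω => (hφ.2 _).1, ?_⟩
  have := integral_mono (hφ.integrable_comp hX) (integrable_const (1 : ℝ)) fun ω => (hφ.2 _).2
  simpa using this

theorem IsTest.gaussianStep {p : ℕ} {m : Eucl p → Eucl p} (hm : Measurable m) (σ : ℝ)
    {φ : Eucl p → ℝ} (hφ : IsTest φ) : IsTest (gaussianStep m σ φ) := by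
  refine ⟨?_, fun y => hφ.integral_mem_Icc (by fun_prop)⟩
  have h : Measurable (fun q : Eucl p × Eucl p => φ (m q.1 + σ • q.2)) :=
    hφ.1.comp (by fun_prop)
  exact h.stronglyMeasurable.integral_prod_right.measurable

theorem IsTest.iterate_gaussianStep {p : ℕ} {m : Eucl p → Eucl p} (hm : Measurable m) (σ : ℝ)
    {φ : Eucl p → ℝ} (hφ : IsTest φ) (k : ℕ) : IsTest ((_root_.gaussianStep m σ)^[k] φ) := by
  induction k with
  | zero => exact hφ
  | succ k ih =>
    rw [Function.iterate_succ_apply']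
    exact ih.gaussianStep hm σ

/-- One step of Gaussian composition for hockey-stick divergences. -/
theorem gaussianStep_sub_le {p : ℕ} {m m' : Eucl p → Eucl p} {σ : ℝ} (hσ : 0 < σ) {u w : Eucl p → ℝ}
    (hu : IsTest u) (hw : IsTest w) {v δ : ℝ≥0} (y : Eucl p) (hδ : ‖m' y - m y‖ ≤ σ * δ)
    (h : ∀ x c, u x - c * w x ≤ gaussianHockeyStick v c) (c : ℝ) :
    gaussianStep m' σ u y - c * gaussianStep m σ w y ≤ gaussianHockeyStick (δ ^ 2 + v) c := by
  -- The drift difference in units of the noise; the log-likelihood ratio of the two steps has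
  -- variance `‖d‖²`.
  set d : Eucl p := σ⁻¹ • (m' y - m y) with hd
  have hdδ : ‖d‖₊ ≤ δ := by
    rw [← NNReal.coe_le_coe, coe_nnnorm, hd, norm_smul, Real.norm_of_nonneg (inv_nonneg.2 hσ.le)]
    rwa [inv_mul_le_iff₀ hσ]
  refine le_trans ?_ (gaussianHockeyStick_mono (add_le_add_left (pow_le_pow_left' hdδ 2) v) c)
  set e : ℝ → ℝ := fun x => Real.exp (x - ((‖d‖₊ ^ 2 : ℝ≥0) : ℝ) / 2) with he
  have hshift : gaussianStep m' σ u y =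
      ∫ z, e (inner ℝ d z) * u (m y + σ • z) ∂(stdGaussian (Eucl p)) := by
    rw [gaussianStep]
    have := integral_stdGaussian_add_const d (f := fun z => u (m y + σ • z))
      (hu.1.comp (by fun_prop))
    simp only [he, NNReal.coe_pow, coe_nnnorm]
    rw [← this]
    refine integral_congr_ae (Eventually.of_forall fun z => congrArg u ?_)
    rw [hd, smul_add, smul_smul, mul_inv_cancel₀ hσ.ne', one_smul]
    abel
  have hint₁ : Integrable (fun z => e (inner ℝ d z) * u (m y + σ • z)) (stdGaussian (Eucl p)) := by
    refine (integrable_exp_inner_stdGaussian d _).mul_bdd (c := 1)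
      (hu.1.comp (by fun_prop)).aestronglyMeasurable (Eventually.of_forall fun z => ?_)
    rw [Real.norm_of_nonneg (hu.2 _).1]
    exact (hu.2 _).2
  have hint₂ : Integrable (fun z => c * w (m y + σ • z)) (stdGaussian (Eucl p)) :=
    (hw.integrable_comp (by fun_prop)).const_mul c
  have hpos : ∀ x, 0 < e x := fun x => Real.exp_pos _
  set H : ℝ → ℝ := fun x => ∫ q, max (e x * Real.exp (q - v / 2) - c) 0 ∂(gaussianReal 0 v) with hH
  have hHint : Integrable H (gaussianReal 0 (‖d‖₊ ^ 2)) :=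
    (integrable_hockeyStick_prod (‖d‖₊ ^ 2) v c).integral_prod_left
  have hHe : ∀ x, H x = e x * gaussianHockeyStick v (c / e x) := by
    intro x
    rw [gaussianHockeyStick, ← integral_const_mul]
    refine integral_congr_ae (Eventually.of_forall fun q => ?_)
    simp only []
    rw [mul_max_of_nonneg _ _ (hpos x).le, mul_sub, mul_div_cancel₀ _ (hpos x).ne', mul_zero]
  have hmeas : AEMeasurable (fun z : Eucl p => (inner ℝ d z : ℝ)) (stdGaussian (Eucl p)) := by
    fun_prop
  rw [← stdGaussian_map_inner] at hHint
  have hgoal : gaussianHockeyStick (‖d‖₊ ^ 2 + v) c =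
      ∫ z, H (inner ℝ d z) ∂(stdGaussian (Eucl p)) := by
    rw [gaussianHockeyStick_add, ← integral_map hmeas hHint.aestronglyMeasurable,
      stdGaussian_map_inner]
  rw [hgoal, hshift, gaussianStep, ← integral_const_mul, ← integral_sub hint₁ hint₂]
  refine integral_mono (hint₁.sub hint₂) (hHint.comp_aemeasurable hmeas) fun z => ?_
  -- The hypothesis is needed at every level, since the likelihood ratio of this step rescales `c`
  -- to a level depending on `z`.
  have hx := mul_le_mul_of_nonneg_left (h (m y + σ • z) (c / e (inner ℝ d z)))
    (hpos (inner ℝ d z)).le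
  simp only [hHe]
  refine le_trans (le_of_eq ?_) hx
  rw [mul_sub, ← mul_assoc, mul_div_cancel₀ _ (hpos _).ne']

/-- Adaptive composition of Gaussian mechanisms. -/
theorem iterate_gaussianStep_sub_le {p : ℕ} {m m' : Eucl p → Eucl p} (hm : Measurable m)
    (hm' : Measurable m') {σ : ℝ} (hσ : 0 < σ) {δ : ℝ≥0} (hδ : ∀ y, ‖m' y - m y‖ ≤ σ * δ)
    {φ : Eucl p → ℝ} (hφ : IsTest φ) (k : ℕ) (y : Eucl p) (c : ℝ) :
    (gaussianStep m' σ)^[k] φ y - c * (gaussianStep m σ)^[k] φ y ≤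
      gaussianHockeyStick (k * δ ^ 2) c := by
  induction k generalizing y c with
  | zero =>
    simp only [Function.iterate_zero, id, Nat.cast_zero, zero_mul, gaussianHockeyStick_zero]
    have := hφ.2 y
    rw [← one_sub_mul]
    exact (mul_le_mul_of_nonneg_right (le_max_left (1 - c) 0) this.1).trans
      (mul_le_of_le_one_right (le_max_right _ _) this.2)
  | succ k ih =>
    rw [Function.iterate_succ_apply', Function.iterate_succ_apply',
      show ((k + 1 : ℕ) : ℝ≥0) * δ ^ 2 = δ ^ 2 + k * δ ^ 2 by push_cast; ring]
    exact gaussianStep_sub_le hσ (hφ.iterate_gaussianStep hm' σ k)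
      (hφ.iterate_gaussianStep hm σ k) y (hδ y) ih c

/-! ### Noisy gradient descent as a Markov chain, and its privacy. -/

section NoisyGradientDescent

variable {𝒳 Ω : Type*} {n p K : ℕ} {Ψ : 𝒳 → Eucl p → Eucl p} {η B μ : ℝ}
  {θinit : Eucl p} {x : Fin n → 𝒳}

theorem measurable_empScore (hΨ : ∀ a, Measurable (Ψ a)) : Measurable (empScore Ψ x) := by
  unfold empScore
  fun_prop

theorem ngd_congr {z z' : ℕ → Eucl p} {k : ℕ} (h : ∀ j < k, z j = z' j) :
    ngd Ψ η B μ K θinit z x k = ngd Ψ η B μ K θinit z' x k := by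
  induction k with
  | zero => rfl
  | succ k ih => rw [ngd, ngd, ih fun j hj => h j (hj.trans k.lt_succ_self), h k k.lt_succ_self]

theorem measurable_ngd (hΨ : ∀ a, Measurable (Ψ a)) (k : ℕ) :
    Measurable (fun z : ℕ → Eucl p => ngd Ψ η B μ K θinit z x k) := by
  induction k with
  | zero => exact measurable_const
  | succ k ih =>
    simp only [ngd]
    have := (measurable_empScore (x := x) hΨ).comp ih
    simp only [Function.comp_def] at this
    fun_prop

/-- The noiseless update of the iterates. -/
def gradientStep (Ψ : 𝒳 → Eucl p → Eucl p) (η : ℝ) (x : Fin n → 𝒳) (θ : Eucl p) : Eucl p :=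
  θ - η • empScore Ψ x θ

theorem measurable_gradientStep (hΨ : ∀ a, Measurable (Ψ a)) :
    Measurable (gradientStep Ψ η x) := by
  have := measurable_empScore (x := x) hΨ
  unfold gradientStep
  fun_prop

/-- The noise vectors with index in `s`, extended by zero to a sequence. -/
def extendNoise (s : Finset (Fin K)) (u : s → Eucl p) (j : ℕ) : Eucl p :=
  if h : ∃ hj : j < K, (⟨j, hj⟩ : Fin K) ∈ s then u ⟨⟨j, h.1⟩, h.2⟩ else 0

theorem measurable_extendNoise (s : Finset (Fin K)) :
    Measurable (extendNoise s : (s → Eucl p) → ℕ → Eucl p) := by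
  refine measurable_pi_lambda _ fun j => ?_
  unfold extendNoise
  split_ifs with h
  · exact measurable_pi_apply _
  · exact measurable_const

/-- The `k`-th iterate sees only the noise with index below `k`. Nothing is known about `Z j` for `j
≥ K`, so measurability and independence must pass through this finite family. -/
theorem ngd_eq_extendNoise {Z : ℕ → Ω → Eucl p} {s : Finset (Fin K)} {k : ℕ} (hk : k ≤ K)
    (hs : ∀ j : Fin K, (j : ℕ) < k → j ∈ s) (ω : Ω) :
    ngd Ψ η B μ K θinit (fun k => Z k ω) x k =
      ngd Ψ η B μ K θinit (extendNoise s fun i => Z i ω) x k := by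
  refine ngd_congr fun j hj => ?_
  rw [extendNoise, dif_pos ⟨hj.trans_le hk, hs ⟨j, hj.trans_le hk⟩ hj⟩]

variable [MeasurableSpace Ω] {P : Measure Ω} {Z : ℕ → Ω → Eucl p}

theorem IsGaussianNoise.aemeasurable_ngd (hZ : IsGaussianNoise P K Z)
    (hΨ : ∀ a, Measurable (Ψ a)) {k : ℕ} (hk : k ≤ K) :
    AEMeasurable (fun ω => ngd Ψ η B μ K θinit (fun k => Z k ω) x k) P := by
  have h := funext (ngd_eq_extendNoise (Ψ := Ψ) (η := η) (B := B) (μ := μ) (θinit := θinit)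
    (x := x) (Z := Z) (s := Finset.univ) hk fun j _ => Finset.mem_univ j)
  rw [h]
  exact ((measurable_ngd hΨ k).comp (measurable_extendNoise _)).comp_aemeasurable
    (aemeasurable_pi_lambda _ fun i => (hZ.hasLaw i i.1.2).aemeasurable)

theorem IsGaussianNoise.indepFun_ngd (hZ : IsGaussianNoise P K Z)
    (hΨ : ∀ a, Measurable (Ψ a)) {k : ℕ} (hk : k < K) :
    IndepFun (fun ω => ngd Ψ η B μ K θinit (fun k => Z k ω) x k) (Z k) P := by
  set S : Finset (Fin K) := Finset.univ.filter fun j => (j : ℕ) < k with hS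
  have h := funext (ngd_eq_extendNoise (Ψ := Ψ) (η := η) (B := B) (μ := μ) (θinit := θinit)
    (x := x) (Z := Z) (s := S) hk.le fun j hj => by simp [hS, hj])
  rw [h]
  have hind := hZ.indep.indepFun_finset₀ S {⟨k, hk⟩} (by simp [hS])
    fun i => (hZ.hasLaw i i.2).aemeasurable
  exact hind.comp ((measurable_ngd hΨ k).comp (measurable_extendNoise S))
    (measurable_pi_apply (⟨⟨k, hk⟩, Finset.mem_singleton_self _⟩ : ({⟨k, hk⟩} : Finset (Fin K))))

theorem IsGaussianNoise.integral_ngd [IsProbabilityMeasure P] (hZ : IsGaussianNoise P K Z)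
    (hΨ : ∀ a, Measurable (Ψ a)) {k : ℕ} (hk : k ≤ K) {φ : Eucl p → ℝ} (hφ : IsTest φ) :
    ∫ ω, φ (ngd Ψ η B μ K θinit (fun k => Z k ω) x k) ∂P =
      (gaussianStep (gradientStep Ψ η x) (2 * η * B * √(K : ℝ) / (μ * n)))^[k] φ θinit := by
  induction k generalizing φ with
  | zero => simp [ngd]
  | succ k ih =>
    have hm := measurable_gradientStep (η := η) (x := x) hΨ
    -- The last step is absorbed into the test, so the induction hypothesis applies to the averaged
    -- test.
    rw [Function.iterate_succ_apply, ← ih (k.le_succ.trans hk) (hφ.gaussianStep hm _)]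
    set σ := 2 * η * B * √(K : ℝ) / (μ * n)
    have hX := hZ.aemeasurable_ngd (η := η) (B := B) (μ := μ) (θinit := θinit) (x := x) hΨ
      (k.le_succ.trans hk)
    have hlaw := hZ.hasLaw k hk
    set X := fun ω => ngd Ψ η B μ K θinit (fun k => Z k ω) x k with hXdef
    have hprod : P.map (fun ω => (X ω, Z k ω)) = (P.map X).prod (stdGaussian (Eucl p)) := by
      rw [(indepFun_iff_map_prod_eq_prod_map_map hX hlaw.aemeasurable).1
        (hZ.indepFun_ngd hΨ hk), hlaw.map_eq]
    have : IsProbabilityMeasure (P.map X) := Measure.isProbabilityMeasure_map hX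
    have hf : Measurable (fun q : Eucl p × Eucl p => φ (gradientStep Ψ η x q.1 + σ • q.2)) :=
      hφ.1.comp (by fun_prop)
    calc ∫ ω, φ (ngd Ψ η B μ K θinit (fun k => Z k ω) x (k + 1)) ∂P
        = ∫ q, φ (gradientStep Ψ η x q.1 + σ • q.2) ∂(P.map fun ω => (X ω, Z k ω)) := by
          rw [integral_map (hX.prodMk hlaw.aemeasurable) hf.aestronglyMeasurable]
          rfl
      _ = ∫ y, gaussianStep (gradientStep Ψ η x) σ φ y ∂(P.map X) := by
          rw [hprod, integral_prod _ (hφ.integrable_comp (by fun_prop))]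
          rfl
      _ = _ := by
          rw [integral_map hX (hφ.gaussianStep hm σ).1.aestronglyMeasurable]

theorem norm_gradientStep_sub_le (hη : 0 < η) {x' : Fin n → 𝒳} (hxx' : Neighbours x x')
    (hB : ∀ a θ, ‖Ψ a θ‖ ≤ B) (θ : Eucl p) :
    ‖gradientStep Ψ η x' θ - gradientStep Ψ η x θ‖ ≤ η * (2 * B / n) := by
  obtain ⟨i, hi⟩ := Set.ncard_eq_one.1 hxx'
  have hne : ∀ j, j ≠ i → x j = x' j := fun j hj => by
    by_contra h
    exact hj (by simpa [hi] using (show j ∈ {i : Fin n | x i ≠ x' i} from h))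
  have hsum : ∑ j, Ψ (x j) θ - ∑ j, Ψ (x' j) θ = Ψ (x i) θ - Ψ (x' i) θ := by
    rw [← Finset.sum_sub_distrib]
    exact Finset.sum_eq_single i (fun j _ hj => by rw [hne j hj, sub_self]) (by simp)
  have : gradientStep Ψ η x' θ - gradientStep Ψ η x θ =
      η • (1 / (n : ℝ)) • (Ψ (x i) θ - Ψ (x' i) θ) := by
    rw [← hsum, gradientStep, gradientStep, empScore, empScore]
    module
  rw [this, norm_smul, norm_smul, Real.norm_of_nonneg hη.le,
    Real.norm_of_nonneg (by positivity)]
  gcongr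
  rw [one_div, inv_mul_eq_div]
  gcongr
  linarith [norm_sub_le (Ψ (x i) θ) (Ψ (x' i) θ), hB (x i) θ, hB (x' i) θ]

theorem IsGaussianNoise.isGDP_ngd [IsProbabilityMeasure P] (hZ : IsGaussianNoise P K Z)
    (hn : 1 ≤ n) (hK : 1 ≤ K) (hη : 0 < η) (hB : 0 < B) (hμ : 0 < μ)
    (hΨ : ∀ a, Measurable (Ψ a)) (hΨB : ∀ a θ, ‖Ψ a θ‖ ≤ B) :
    IsGDP μ (fun x : Fin n → 𝒳 =>
      P.map (fun ω => ngd Ψ η B μ K θinit (fun k => Z k ω) x K)) := by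
  refine ⟨gaussianTradeoff μ, ⟨convexOn_gaussianTradeoff hμ, continuousOn_gaussianTradeoff hμ,
    antitoneOn_gaussianTradeoff hμ, fun α hα => gaussianTradeoff_le_one_sub hμ hα,
    fun x => Measure.isProbabilityMeasure_map (hZ.aemeasurable_ngd hΨ le_rfl), ?_⟩,
    fun α _ => le_rfl⟩
  intro x x' hxx' α hα φ hφ hle
  have hX := fun x : Fin n → 𝒳 => hZ.aemeasurable_ngd (η := η) (B := B) (μ := μ) (θinit := θinit)
    (x := x) hΨ le_rfl
  rw [integral_map (hX _) hφ.1.aestronglyMeasurable] at hle ⊢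
  refine power_le_of_hockeyStick_le hμ hα (hφ.integral_mem_Icc (hX x')).2 hle fun c => ?_
  rw [hZ.integral_ngd hΨ le_rfl hφ, hZ.integral_ngd hΨ le_rfl hφ]
  have hn' : (0 : ℝ) < n := by exact_mod_cast hn
  have hK' : (0 : ℝ) < K := by exact_mod_cast hK
  have hsK : 0 < √(K : ℝ) := Real.sqrt_pos.2 hK'
  have hδ : ((Real.toNNReal (μ / √(K : ℝ)) : ℝ≥0) : ℝ) = μ / √(K : ℝ) :=
    Real.coe_toNNReal _ (by positivity)
  -- Each step contributes sensitivity `μ/√K` relative to the noise, hence total variance `μ²`.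
  have hvar : (K : ℝ≥0) * Real.toNNReal (μ / √(K : ℝ)) ^ 2 = Real.toNNReal (μ ^ 2) := by
    ext
    rw [NNReal.coe_mul, NNReal.coe_pow, hδ, Real.coe_toNNReal _ (sq_nonneg μ), div_pow,
      Real.sq_sqrt hK'.le, NNReal.coe_natCast]
    field_simp
  rw [← hvar]
  refine iterate_gaussianStep_sub_le (measurable_gradientStep hΨ) (measurable_gradientStep hΨ)
    (by positivity) (fun y => (norm_gradientStep_sub_le hη hxx' hΨB y).trans_eq ?_) hφ K θinit c
  rw [hδ]
  field_simp

end NoisyGradientDescent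

/-! ### Contraction of gradient descent near the minimizer. -/

section StronglyConvex

variable {p : ℕ} {Θ : Set (Eucl p)} {L : Eucl p → ℝ} {g : Eucl p → Eucl p} {τ₁ τ₂ η r : ℝ}
  {θ₀ θhat θ : Eucl p}

theorem norm_sub_smul_sub_sq (t : ℝ) (θ θhat v : Eucl p) :
    ‖θ - t • v - θhat‖ ^ 2 =
      ‖θ - θhat‖ ^ 2 - 2 * t * inner ℝ v (θ - θhat) + t * (t * ‖v‖ ^ 2) := by
  rw [sub_right_comm, norm_sub_sq_real, real_inner_smul_right, norm_smul, mul_pow,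
    Real.norm_eq_abs, sq_abs, real_inner_comm]
  ring

/-- The descent inequality along a gradient step of length `t` that stays in the domain. -/
theorem mul_norm_sq_gradient_le {S : Set (Eucl p)} (hsc : IsStronglyConvexOn τ₁ S L g)
    (hsm : IsSmoothOn τ₂ Θ L g) (hS : S ⊆ Θ) (hmin : IsMinOn L Θ θhat) (hθhat : θhat ∈ S)
    (hθ : θ ∈ S) {t : ℝ} (ht0 : 0 ≤ t) (ht : τ₂ * t ≤ 1 / 2) (hmem : θ - t • g θ ∈ Θ) :
    t * ‖g θ‖ ^ 2 ≤ 2 * (inner ℝ (g θ) (θ - θhat) - τ₁ * ‖θ - θhat‖ ^ 2) := by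
  have h1 := hsm _ hmem θ (hS hθ)
  have h2 := hsc θhat hθhat θ hθ
  have h3 : L θhat ≤ L (θ - t • g θ) := hmin hmem
  rw [sub_sub_cancel_left, inner_neg_right, real_inner_smul_right, real_inner_self_eq_norm_sq,
    norm_neg, norm_smul, mul_pow, Real.norm_eq_abs, sq_abs] at h1
  rw [← neg_sub θ θhat, inner_neg_right, norm_neg] at h2
  have h4 := mul_le_mul_of_nonneg_right ht (mul_nonneg ht0 (sq_nonneg ‖g θ‖))
  nlinarith

theorem gradient_eq_zero_of_isMinOn (hr : 0 < r) (hη : 0 < η) (hητ : τ₂ * η ≤ 1 / 2)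
    (hτ₂ : 0 < τ₂) (hball : Metric.closedBall θ₀ r ⊆ Θ)
    (hsc : IsStronglyConvexOn τ₁ (Metric.closedBall θ₀ r) L g) (hsm : IsSmoothOn τ₂ Θ L g)
    (hmin : IsMinOn L Θ θhat) (hθhat : θhat ∈ Metric.closedBall θ₀ (r / 2)) : g θhat = 0 := by
  -- A step this short from `θhat` stays in the ball; the descent inequality at `θ = θhat` then
  -- forces `t ‖g θhat‖² ≤ 0`.
  set t := min η (r / 2 / (‖g θhat‖ + 1)) with ht
  have ht0 : 0 < t := lt_min hη (by positivity)
  have htη : t ≤ η := min_le_left _ _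
  have htg : t * ‖g θhat‖ ≤ r / 2 := by
    have h1 : t ≤ r / 2 / (‖g θhat‖ + 1) := min_le_right _ _
    rw [le_div_iff₀ (by positivity)] at h1
    linarith
  have hin : θhat ∈ Metric.closedBall θ₀ r := Metric.closedBall_subset_closedBall (by linarith) hθhat
  have hmem : θhat - t • g θhat ∈ Metric.closedBall θ₀ r := by
    rw [mem_closedBall_iff_norm] at hθhat ⊢
    rw [sub_right_comm]
    have := norm_sub_le (θhat - θ₀) (t • g θhat)
    rw [norm_smul, Real.norm_of_nonneg ht0.le] at this
    linarith
  have := mul_norm_sq_gradient_le hsc hsm hball hmin hin hin ht0.le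
    ((mul_le_mul_of_nonneg_left htη hτ₂.le).trans hητ) (hball hmem)
  simp only [sub_self, inner_zero_right, norm_zero] at this
  have h0 : ‖g θhat‖ ^ 2 ≤ 0 := by nlinarith
  exact norm_eq_zero.1 (pow_eq_zero_iff two_ne_zero |>.1 (h0.antisymm (sq_nonneg _)))

theorem mem_closedBall_of_norm_sub_le (hθhat : θhat ∈ Metric.closedBall θ₀ (r / 2))
    (hθ : ‖θ - θhat‖ ≤ r / 2) : θ ∈ Metric.closedBall θ₀ r := by
  rw [mem_closedBall_iff_norm] at *
  linarith [norm_sub_le_norm_sub_add_norm_sub θ θhat θ₀]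

/-- Gradient descent contracts towards the minimizer within the ball of strong convexity. -/
theorem norm_gradient_step_sq_le (hr : 0 < r) (hη : 0 < η) (hητ : τ₂ * η ≤ 1 / 2)
    (hτ₁ : 0 < τ₁) (hτ₂ : 0 < τ₂) (hball : Metric.closedBall θ₀ r ⊆ Θ)
    (hsc : IsStronglyConvexOn τ₁ (Metric.closedBall θ₀ r) L g) (hsm : IsSmoothOn τ₂ Θ L g)
    (hmin : IsMinOn L Θ θhat) (hθhat : θhat ∈ Metric.closedBall θ₀ (r / 2))
    (hθ : ‖θ - θhat‖ ≤ r / 2) :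
    ‖θ - η • g θ - θhat‖ ^ 2 ≤ (1 - 2 * η * τ₁) * ‖θ - θhat‖ ^ 2 := by
  have hin := mem_closedBall_of_norm_sub_le hθhat hθ
  have hin' : θhat ∈ Metric.closedBall θ₀ r :=
    Metric.closedBall_subset_closedBall (by linarith) hθhat
  have key : ∀ t, 0 ≤ t → t ≤ η → ‖θ - t • g θ - θhat‖ ^ 2 ≤ ‖θ - θhat‖ ^ 2 →
      t * ‖g θ‖ ^ 2 ≤ 2 * (inner ℝ (g θ) (θ - θhat) - τ₁ * ‖θ - θhat‖ ^ 2) := by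
    intro t ht0 htη ht
    refine mul_norm_sq_gradient_le hsc hsm hball hmin hin' hin ht0
      ((mul_le_mul_of_nonneg_left htη hτ₂.le).trans hητ) (hball ?_)
    exact mem_closedBall_of_norm_sub_le hθhat
      ((pow_le_pow_iff_left₀ (norm_nonneg _) (norm_nonneg _) two_ne_zero).1 ht |>.trans hθ)
  have hstep : ∀ t, 0 ≤ t → t ≤ η → t * ‖g θ‖ ^ 2 ≤ 2 * inner ℝ (g θ) (θ - θhat) →
      t * ‖g θ‖ ^ 2 ≤ 2 * (inner ℝ (g θ) (θ - θhat) - τ₁ * ‖θ - θhat‖ ^ 2) := by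
    intro t ht0 htη ht
    refine key t ht0 htη ?_
    rw [norm_sub_smul_sub_sq]
    nlinarith [mul_le_mul_of_nonneg_left ht ht0]
  -- Smoothness holds only on `Θ`, so the full step must first be shown to stay there. It does if it
  -- does not increase the distance to `θhat`. Otherwise a shorter step of length `2⟨g θ, θ - θhat⟩
  -- / ‖g θ‖²` preserves that distance exactly, and the descent inequality for it contradicts `τ₁ >
  -- 0`.
  rcases eq_or_ne θ θhat with rfl | hne
  · rw [gradient_eq_zero_of_isMinOn hr hη hητ hτ₂ hball hsc hsm hmin hθhat]
    simp
  have hD : 0 < ‖θ - θhat‖ ^ 2 := by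
    have := norm_pos_iff.2 (sub_ne_zero.2 hne)
    positivity
  have hτD := mul_pos hτ₁ hD
  have ha := key 0 le_rfl hη.le (by simp)
  rcases le_or_gt (η * ‖g θ‖ ^ 2) (2 * inner ℝ (g θ) (θ - θhat)) with hle | hgt
  · have h1 := mul_le_mul_of_nonneg_left (hstep η hη.le le_rfl hle) hη.le
    rw [norm_sub_smul_sub_sq]
    linarith
  · have hG : 0 < ‖g θ‖ ^ 2 := by
      by_contra hG
      nlinarith [sq_nonneg ‖g θ‖]
    have heq : 2 * inner ℝ (g θ) (θ - θhat) / ‖g θ‖ ^ 2 * ‖g θ‖ ^ 2 =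
        2 * inner ℝ (g θ) (θ - θhat) := div_mul_cancel₀ _ hG.ne'
    have := hstep (2 * inner ℝ (g θ) (θ - θhat) / ‖g θ‖ ^ 2)
      (div_nonneg (by linarith) hG.le) (by rw [div_le_iff₀ hG]; exact hgt.le) heq.le
    rw [heq] at this
    linarith

theorem norm_gradient_step_le (hr : 0 < r) (hη : 0 < η) (hητ : τ₂ * η ≤ 1 / 2)
    (hτ₁ : 0 < τ₁) (hτ₂ : 0 < τ₂) (hball : Metric.closedBall θ₀ r ⊆ Θ)
    (hsc : IsStronglyConvexOn τ₁ (Metric.closedBall θ₀ r) L g) (hsm : IsSmoothOn τ₂ Θ L g)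
    (hmin : IsMinOn L Θ θhat) (hθhat : θhat ∈ Metric.closedBall θ₀ (r / 2))
    (hθ : ‖θ - θhat‖ ≤ r / 2) :
    ‖θ - η • g θ - θhat‖ ≤ Real.exp (-(η * τ₁)) * ‖θ - θhat‖ := by
  rw [← pow_le_pow_iff_left₀ (norm_nonneg _) (by positivity) two_ne_zero, mul_pow,
    ← Real.exp_nat_mul]
  refine (norm_gradient_step_sq_le hr hη hητ hτ₁ hτ₂ hball hsc hsm hmin hθhat hθ).trans ?_
  gcongr
  have := Real.add_one_le_exp (((2 : ℕ) : ℝ) * -(η * τ₁))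
  push_cast at this ⊢
  linarith

/-- Sublevel sets at height `r² τ₁ / 4` lie in the ball of radius `r / 2` about the minimizer. -/
theorem norm_sub_le_of_excess_le (hr : 0 < r) (hτ₁ : 0 < τ₁) (hconv : ConvexOn ℝ Θ L)
    (hball : Metric.closedBall θ₀ r ⊆ Θ)
    (hsc : IsStronglyConvexOn τ₁ (Metric.closedBall θ₀ r) L g) (hg : g θhat = 0)
    (hθhat : θhat ∈ Metric.closedBall θ₀ (r / 2)) (hθ : θ ∈ Θ)
    (hexc : L θ - L θhat ≤ r ^ 2 / 4 * τ₁) : ‖θ - θhat‖ ≤ r / 2 := by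
  by_contra! hlt
  have hD : 0 < ‖θ - θhat‖ := by linarith
  have hin' : θhat ∈ Metric.closedBall θ₀ r :=
    Metric.closedBall_subset_closedBall (by linarith) hθhat
  -- The point of the segment at distance `r/2` from `θhat` has excess at least `τ₁ r²/4` by strong
  -- convexity, but strictly less by convexity.
  set t := r / 2 / ‖θ - θhat‖ with ht
  have ht0 : 0 < t := by positivity
  have ht1 : t < 1 := by rwa [ht, div_lt_one hD]
  have hy : (1 - t) • θhat + t • θ - θhat = t • (θ - θhat) := by module
  have hnorm : ‖(1 - t) • θhat + t • θ - θhat‖ = r / 2 := by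
    rw [hy, norm_smul, Real.norm_of_nonneg ht0.le, ht, div_mul_cancel₀ _ hD.ne']
  have h1 := hconv.2 (hball hin') hθ (by linarith : 0 ≤ 1 - t) ht0.le (by ring)
  have h2 := hsc _ (mem_closedBall_of_norm_sub_le hθhat hnorm.le) θhat hin'
  rw [hg, inner_zero_left, hnorm] at h2
  simp only [smul_eq_mul] at h1
  have h3 := mul_le_mul_of_nonneg_left hexc ht0.le
  have h4 : t * (r ^ 2 / 4 * τ₁) < r ^ 2 / 4 * τ₁ := mul_lt_of_lt_one_left (by positivity) ht1
  nlinarith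

/-- Strong convexity forces the gradient to grow along the ball. -/
theorem mul_radius_le_of_norm_gradient_le (hp : 0 < p) (hr : 0 < r)
    (hsc : IsStronglyConvexOn τ₁ (Metric.closedBall θ₀ r) L g) (hg : g θhat = 0)
    (hθhat : θhat ∈ Metric.closedBall θ₀ (r / 2)) {B : ℝ}
    (hB : ∀ θ ∈ Metric.closedBall θ₀ r, ‖g θ‖ ≤ B) : τ₁ * r ≤ B := by
  have hin' : θhat ∈ Metric.closedBall θ₀ r :=
    Metric.closedBall_subset_closedBall (by linarith) hθhat
  set e : Eucl p := EuclideanSpace.single ⟨0, hp⟩ (r / 2) with he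
  have hen : ‖e‖ = r / 2 := by simp [he, abs_of_pos hr]
  have hsub : θhat + e - θhat = e := add_sub_cancel_left _ _
  have hin := mem_closedBall_of_norm_sub_le hθhat (θ := θhat + e) (by rw [hsub, hen])
  have h1 := hsc _ hin θhat hin'
  have h2 := hsc θhat hin' _ hin
  rw [hsub, hg, inner_zero_left, hen] at h1
  rw [sub_add_cancel_left, inner_neg_right, norm_neg, hen] at h2
  have h3 := real_inner_le_norm (g (θhat + e)) e
  have h4 := mul_le_mul_of_nonneg_right (hB _ hin) (norm_nonneg e)
  rw [hen] at h3 h4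
  have : (τ₁ * r) * r ≤ B * r := by nlinarith
  exact le_of_mul_le_mul_right this hr

end StronglyConvex

/-! ### Error recursion, noise event and sample size conditions. -/

theorem norm_empScore_le {𝒳 : Type*} {n p : ℕ} {Ψ : 𝒳 → Eucl p → Eucl p} {x : Fin n → 𝒳}
    {θ : Eucl p} {B : ℝ} (hn : 0 < n) (h : ∀ a, ‖Ψ a θ‖ ≤ B) : ‖empScore Ψ x θ‖ ≤ B := by
  have hn' : (0 : ℝ) < n := by exact_mod_cast hn
  rw [empScore, norm_smul, Real.norm_of_nonneg (by positivity), one_div, inv_mul_le_iff₀ hn']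
  refine (norm_sum_le _ _).trans ((Finset.sum_le_card_nsmul _ _ B fun i _ => h _).trans_eq ?_)
  simp

/-- A perturbed contraction on a ball stays in the ball and converges up to the noise level. -/
theorem norm_iterate_sub_le_of_contraction {E : Type*} [NormedAddCommGroup E] {m : E → E}
    {θ w : ℕ → E} {a : E} {κ R ν : ℝ} {K : ℕ} (hκ0 : 0 ≤ κ) (hκ1 : κ < 1) (hν0 : 0 ≤ ν)
    (hm : ∀ y, ‖y - a‖ ≤ R → ‖m y - a‖ ≤ κ * ‖y - a‖) (hθ : ∀ k < K, θ (k + 1) = m (θ k) + w k)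
    (hw : ∀ k < K, ‖w k‖ ≤ ν) (hν : ν ≤ (1 - κ) * R) (h0 : ‖θ 0 - a‖ ≤ R) {k : ℕ} (hk : k ≤ K) :
    ‖θ k - a‖ ≤ R ∧ ‖θ k - a‖ ≤ κ ^ k * R + ν / (1 - κ) := by
  have h1κ : 0 < 1 - κ := by linarith
  induction k with
  | zero => exact ⟨h0, by simpa using h0.trans (le_add_of_nonneg_right (div_nonneg hν0 h1κ.le))⟩
  | succ k ih =>
    obtain ⟨hR, hk'⟩ := ih (k.le_succ.trans hk)
    have hstep : ‖θ (k + 1) - a‖ ≤ κ * ‖θ k - a‖ + ν := by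
      rw [hθ k hk, add_sub_right_comm]
      exact (norm_add_le _ _).trans (add_le_add (hm _ hR) (hw k hk))
    constructor
    · have := mul_le_mul_of_nonneg_left hR hκ0
      linarith
    · have := mul_le_mul_of_nonneg_left hk' hκ0
      have h2 : ν / (1 - κ) = κ * (ν / (1 - κ)) + ν := by
        field_simp
        ring
      rw [h2, pow_succ]
      linarith

theorem IsGaussianNoise.one_sub_le_measureReal {Ω : Type*} [MeasurableSpace Ω] {P : Measure Ω}
    [IsProbabilityMeasure P] {p K : ℕ} {Z : ℕ → Ω → Eucl p} (hZ : IsGaussianNoise P K Z)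
    {ξ : ℝ} (hK : 0 < K) (hξ0 : 0 < ξ) (hξ1 : ξ < 1) {A : Set Ω}
    (hA : ∀ ω, (∀ k < K, ‖Z k ω‖ ≤ √(p : ℝ) + √(2 * Real.log (K / ξ))) → ω ∈ A) :
    1 - ξ ≤ P.real A := by
  have hK' : (1 : ℝ) ≤ K := by exact_mod_cast hK
  have hlog : 0 ≤ Real.log (K / ξ) := Real.log_nonneg (by rw [le_div_iff₀ hξ0]; linarith)
  set s := √(2 * Real.log (K / ξ)) with hs
  have hsub : Aᶜ ⊆ ⋃ k ∈ Finset.range K, {ω | √(p : ℝ) + s < ‖Z k ω‖} := by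
    intro ω hω
    by_contra h
    refine hω (hA ω fun k hk => ?_)
    simp only [Set.mem_iUnion, not_exists] at h
    exact not_lt.1 (h k (Finset.mem_range.2 hk))
  have htail : ∀ k ∈ Finset.range K, P.real {ω | √(p : ℝ) + s < ‖Z k ω‖} ≤ ξ / K := by
    intro k hk
    have hmeas : MeasurableSet {z : Eucl p | √(p : ℝ) + s < ‖z‖} :=
      measurableSet_lt measurable_const measurable_norm
    rw [(hZ.hasLaw k (Finset.mem_range.1 hk)).measureReal_eq hmeas]
    refine (stdGaussian_norm_gt_le (Real.sqrt_nonneg _)).trans_eq ?_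
    rw [Real.sq_sqrt (by linarith), mul_div_cancel_left₀ _ two_ne_zero, Real.exp_neg,
      Real.exp_log (by positivity), inv_div]
  have hcompl : P.real Aᶜ ≤ ξ := by
    refine (measureReal_mono hsub (measure_ne_top _ _)).trans
      ((measureReal_biUnion_finset_le _ _).trans ((Finset.sum_le_card_nsmul _ _ _ htail).trans_eq ?_))
    rw [Finset.card_range, nsmul_eq_mul, mul_div_cancel₀ _ (by positivity)]
  -- Subadditivity suffices, so `A` need not be measurable.
  have hunion := measureReal_union_le (μ := P) A Aᶜ
  rw [Set.union_compl_self, probReal_univ] at hunion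
  linarith

/-- As `n ≥ 2`, the summand `2 / log 2` forces `K ≥ 2`, and the other forces `K a ≥ log n + log M`.
-/
theorem two_le_and_exp_pow_le {a μ M : ℝ} {n K : ℕ} (ha : 0 < a) (hn : 2 ≤ n) (hμ : 0 < μ)
    (hμM : μ ≤ M)
    (hKn : (2 / Real.log 2 + (1 + |Real.log M| / Real.log 2) / a) * Real.log n ≤ K) :
    (2 : ℝ) ≤ K ∧ Real.exp (-a) ^ K ≤ 1 / (μ * n) := by
  have hlog2 : 0 < Real.log 2 := Real.log_pos one_lt_two
  have hn2 : (2 : ℝ) ≤ n := by exact_mod_cast hn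
  have hn0 : (0 : ℝ) < n := by linarith
  have hM : 0 < M := hμ.trans_le hμM
  have hlogn : Real.log 2 ≤ Real.log n := Real.log_le_log two_pos hn2
  have hlogn0 : 0 ≤ Real.log n := hlog2.le.trans hlogn
  have hc0 : 0 ≤ |Real.log M| / Real.log 2 := by positivity
  rw [add_mul] at hKn
  have h1 : 2 / Real.log 2 * Real.log 2 ≤ 2 / Real.log 2 * Real.log n := by gcongr
  rw [div_mul_cancel₀ _ hlog2.ne'] at h1
  have h2 : 0 ≤ (1 + |Real.log M| / Real.log 2) / a * Real.log n := by positivity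
  refine ⟨by linarith, ?_⟩
  have h3 : Real.log n + Real.log M ≤ K * a := by
    have h4 : (1 + |Real.log M| / Real.log 2) / a * Real.log n ≤ K := by linarith
    rw [div_mul_eq_mul_div, div_le_iff₀ ha, add_mul, one_mul] at h4
    have h5 : |Real.log M| / Real.log 2 * Real.log 2 ≤
        |Real.log M| / Real.log 2 * Real.log n := by gcongr
    rw [div_mul_cancel₀ _ hlog2.ne'] at h5
    linarith [le_abs_self (Real.log M)]
  calc Real.exp (-a) ^ K = Real.exp (-(K * a)) := by rw [← Real.exp_nat_mul, mul_neg]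
    _ ≤ Real.exp (-(Real.log n + Real.log M)) := by gcongr
    _ = 1 / (M * n) := by
        rw [Real.exp_neg, Real.exp_add, Real.exp_log hn0, Real.exp_log hM, one_div, mul_comm]
    _ ≤ 1 / (μ * n) := by gcongr

/-- The sample size condition makes the noise smaller than the margin left by the contraction. -/
theorem noise_le_margin {η B μ r κ l n : ℝ} {p K : ℕ} (hη : 0 < η) (hB : 0 < B) (hμ : 0 < μ)
    (hr : 0 < r) (hκ : κ < 1) (hl : 1 / 2 ≤ l) (hn : 0 < n)
    (hnK : (4 * η * |B| * (√(2 * p) + √2) / ((1 - κ) * |r|) + 1) * (√(K * l) / μ) ≤ n) :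
    2 * η * B * √(K : ℝ) / (μ * n) * (√(p : ℝ) + √(2 * l)) ≤ (1 - κ) * (r / 2) := by
  have hκ1 : 0 < 1 - κ := by linarith
  have hl0 : 0 < l := by linarith
  -- The bound `2l ≥ 1` lets `√l` be factored out of the dimension term.
  have hs : √(p : ℝ) + √(2 * l) ≤ (√(2 * p) + √2) * √l := by
    rw [add_mul, ← Real.sqrt_mul (by positivity), ← Real.sqrt_mul (by positivity)]
    gcongr
    nlinarith [show (0 : ℝ) ≤ p from Nat.cast_nonneg p]
  rw [abs_of_pos hB, abs_of_pos hr, Real.sqrt_mul (Nat.cast_nonneg K) l] at hnK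
  have h1 : 4 * η * B * (√(2 * p) + √2) / ((1 - κ) * r) * (√(K : ℝ) * √l / μ) ≤ n :=
    (mul_le_mul_of_nonneg_right (by linarith) (by positivity)).trans hnK
  rw [div_mul_div_comm, div_le_iff₀ (by positivity)] at h1
  rw [div_mul_eq_mul_div, div_le_iff₀ (by positivity)]
  have h2 : 2 * η * B * √(K : ℝ) * (√(p : ℝ) + √(2 * l)) ≤
      2 * η * B * √(K : ℝ) * ((√(2 * p) + √2) * √l) :=
    mul_le_mul_of_nonneg_left hs (by positivity)
  linarith

/-- The optimization error is dominated by the noise level. -/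
theorem pow_mul_radius_le {B μ r κ s τ n : ℝ} {K : ℕ} (hτ : 0 < τ) (hB : 0 < B) (hμ : 0 < μ)
    (hn : 0 < n) (hr : 0 < r) (hrB : τ * r ≤ B) (hκ : κ ^ K ≤ 1 / (μ * n))
    (hs : 1 ≤ √(K : ℝ) * s) :
    κ ^ K * (r / 2) ≤ 1 / (2 * τ) * (B * √(K : ℝ) * s / (μ * n)) := by
  have h1 : r / 2 ≤ 1 / (2 * τ) * B := by
    rw [one_div, inv_mul_eq_div, le_div_iff₀ (by positivity)]
    linarith
  calc κ ^ K * (r / 2) ≤ 1 / (μ * n) * (1 / (2 * τ) * B) :=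
        mul_le_mul hκ h1 (by positivity) (by positivity)
    _ = 1 / (2 * τ) * (B * 1 / (μ * n)) := by ring
    _ ≤ 1 / (2 * τ) * (B * (√(K : ℝ) * s) / (μ * n)) := by gcongr
    _ = _ := by rw [← mul_assoc B]

theorem ngd_convergence {τ₁ τ₂ η : ℝ} (hτ₁ : 0 < τ₁) (hτ₂ : 0 < τ₂) (hη : 0 < η)
    (hητ : τ₂ * η ≤ 1 / 2) {p n K : ℕ} {𝒳 Ω : Type*} {Θ : Set (Eucl p)}
    {ρ : 𝒳 → Eucl p → ℝ} {Ψ : 𝒳 → Eucl p → Eucl p} {B μ M ξ r : ℝ} {θ₀ θhat θinit : Eucl p}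
    {x : Fin n → 𝒳} [MeasurableSpace Ω] {P : Measure Ω} [IsProbabilityMeasure P]
    {Z : ℕ → Ω → Eucl p} (hn : 2 ≤ n) (hB : 0 < B) (hμ : 0 < μ) (hμM : μ ≤ M)
    (hξ0 : 0 < ξ) (hξ1 : ξ < 1) (hr : 0 < r) (hΨ : ∀ a, ∀ θ ∈ Θ, ‖Ψ a θ‖ ≤ B)
    (hconv : ConvexOn ℝ Θ (empLoss ρ x)) (hball : Metric.closedBall θ₀ r ⊆ Θ)
    (hsc : IsStronglyConvexOn τ₁ (Metric.closedBall θ₀ r) (empLoss ρ x) (empScore Ψ x))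
    (hsm : IsSmoothOn τ₂ Θ (empLoss ρ x) (empScore Ψ x))
    (hmin : IsMinOn (empLoss ρ x) Θ θhat) (hθhat : θhat ∈ Metric.closedBall θ₀ (r / 2))
    (hinit : θinit ∈ Θ) (hexc : empLoss ρ x θinit - empLoss ρ x θhat ≤ r ^ 2 / 4 * τ₁)
    (hnK : (4 * η * |B| * (√(2 * p) + √2) / ((1 - Real.exp (-(η * τ₁))) * |r|) + 1) *
      (√(K * Real.log (K / ξ)) / μ) ≤ n)
    (hKn : (2 / Real.log 2 + (1 + |Real.log M| / Real.log 2) / (η * τ₁)) * Real.log n ≤ K)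
    (hZ : IsGaussianNoise P K Z) :
    1 - ξ ≤ P.real {ω | ‖ngd Ψ η B μ K θinit (fun k => Z k ω) x K - θhat‖ ≤
      (2 * η / (1 - Real.exp (-(η * τ₁))) + 1 / (2 * τ₁)) *
        (B * √(K : ℝ) * (√(p : ℝ) + √(2 * Real.log (K / ξ))) / (μ * n))} := by
  have hn0 : (0 : ℝ) < n := by exact_mod_cast two_pos.trans_le hn
  have hητ₁ : 0 < η * τ₁ := mul_pos hη hτ₁
  obtain ⟨hK2, hKexp⟩ := two_le_and_exp_pow_le hητ₁ hn hμ hμM hKn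
  have hK0 : 0 < K := by exact_mod_cast two_pos.trans_le hK2
  have hκ : Real.exp (-(η * τ₁)) < 1 := by
    rw [Real.exp_lt_one_iff]
    linarith
  have hκ1 : 0 < 1 - Real.exp (-(η * τ₁)) := sub_pos.2 hκ
  have hl2 : 1 / 2 ≤ Real.log (K / ξ) := by
    have h1 : (2 : ℝ) ≤ K / ξ := by
      rw [le_div_iff₀ hξ0]
      nlinarith
    linarith [Real.log_le_log two_pos h1, Real.log_two_gt_d9]
  refine hZ.one_sub_le_measureReal hK0 hξ0 hξ1 fun ω hω => ?_
  have hν := noise_le_margin hη hB hμ hr hκ hl2 hn0 hnK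
  generalize hs : √(p : ℝ) + √(2 * Real.log (K / ξ)) = s at hω hν ⊢
  have hs0 : 0 ≤ s := by rw [← hs]; positivity
  rw [Set.mem_ofPred_eq]
  -- For `p = 0` there is no direction along which to prove `τ₁ r ≤ B`, but the error vanishes.
  rcases Nat.eq_zero_or_pos p with rfl | hp
  · rw [Subsingleton.elim (ngd Ψ η B μ K θinit (fun k => Z k ω) x K - θhat) 0, norm_zero]
    positivity
  have hg := gradient_eq_zero_of_isMinOn hr hη hητ hτ₂ hball hsc hsm hmin hθhat
  have hrB : τ₁ * r ≤ B := mul_radius_le_of_norm_gradient_le hp hr hsc hg hθhat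
    fun θ hθ => norm_empScore_le (by omega) fun a => hΨ a θ (hball hθ)
  have hσ0 : 0 ≤ 2 * η * B * √(K : ℝ) / (μ * n) := by positivity
  have hmain := (norm_iterate_sub_le_of_contraction (m := gradientStep Ψ η x)
    (θ := fun k => ngd Ψ η B μ K θinit (fun k => Z k ω) x k)
    (w := fun k => (2 * η * B * √(K : ℝ) / (μ * n)) • Z k ω)
    (a := θhat) (Real.exp_pos _).le hκ (mul_nonneg hσ0 hs0)
    (fun y hy => norm_gradient_step_le hr hη hητ hτ₁ hτ₂ hball hsc hsm hmin hθhat hy)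
    (fun k _ => rfl)
    (fun k hk => by
      rw [norm_smul, Real.norm_of_nonneg hσ0]
      exact mul_le_mul_of_nonneg_left (hω k hk) hσ0)
    hν (norm_sub_le_of_excess_le hr hτ₁ hconv hball hsc hg hθhat hinit hexc) le_rfl).2
  refine hmain.trans ?_
  have hs1 : 1 ≤ √(K : ℝ) * s := by
    have h1 : 1 ≤ √(K : ℝ) := Real.one_le_sqrt.2 (by linarith)
    have h2 : 1 ≤ √(p : ℝ) := Real.one_le_sqrt.2 (by exact_mod_cast hp)
    have h3 : 1 ≤ s := by
      rw [← hs]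
      linarith [Real.sqrt_nonneg (2 * Real.log (K / ξ))]
    exact one_le_mul_of_one_le_of_one_le h1 h3
  rw [add_mul, add_comm]
  refine add_le_add (le_of_eq ?_) (pow_mul_radius_le hτ₁ hB hμ hn0 hr hrB hKexp hs1)
  ring

end

/-! ### The theorem, with explicit constants. -/

theorem theorem3p1 :
    -- (i) privacy
    (∀ (m p n K : ℕ) (𝒳 : Set (Eucl m)) (Ψ : 𝒳 → Eucl p → Eucl p) (η B μ : ℝ) (θinit : Eucl p)
        (Ω : Type*) [MeasurableSpace Ω] (P : Measure Ω) [IsProbabilityMeasure P]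
        (Z : ℕ → Ω → Eucl p),
      1 ≤ n → 1 ≤ K → 0 < η → 0 < B → 0 < μ →
      (∀ a, Measurable (Ψ a)) → (∀ a θ, ‖Ψ a θ‖ ≤ B) →
      IsGaussianNoise P K Z →
      IsGDP μ (fun x : Fin n → 𝒳 =>
        P.map (fun ω => ngd Ψ η B μ K θinit (fun k => Z k ω) x K)))
    ∧
    -- (ii) convergence
    (∀ τ₁ τ₂ η : ℝ, 0 < τ₁ → 0 < τ₂ → 0 < η → η ≤ 1 / 2 * min (1 / τ₂) 1 →
      ∃ (C : ℝ) (c₁ : ℕ → ℝ → ℝ → ℝ) (c₂ : ℝ → ℝ),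
        0 < C ∧ (∀ p r B, 0 < c₁ p r B) ∧ (∀ M, 0 < c₂ M) ∧
        ∀ (m p n K : ℕ) (𝒳 : Set (Eucl m)) (Θ : Set (Eucl p))
          (ρ : 𝒳 → Eucl p → ℝ) (Ψ : 𝒳 → Eucl p → Eucl p)
          (B μ M ξ r : ℝ) (θ₀ θhat θinit : Eucl p) (x : Fin n → 𝒳)
          (Ω : Type*) [MeasurableSpace Ω] (P : Measure Ω) [IsProbabilityMeasure P]
          (Z : ℕ → Ω → Eucl p),
          2 ≤ n → 1 ≤ K → 0 < B → 0 < μ → μ ≤ M → 0 < ξ → ξ < 1 → 0 < r →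
          -- the score is the gradient of the loss and is bounded by `B` on `Θ`
          (∀ a, ∀ θ ∈ Θ, HasGradientWithinAt (ρ a) (Ψ a θ) Θ θ) →
          (∀ a, ∀ θ ∈ Θ, ‖Ψ a θ‖ ≤ B) →
          -- the empirical loss is convex, locally strongly convex and globally smooth
          ConvexOn ℝ Θ (empLoss ρ x) →
          Metric.closedBall θ₀ r ⊆ Θ →
          IsStronglyConvexOn τ₁ (Metric.closedBall θ₀ r) (empLoss ρ x) (empScore Ψ x) →
          IsSmoothOn τ₂ Θ (empLoss ρ x) (empScore Ψ x) →
          -- the M-estimator and the starting value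
          IsMinOn (empLoss ρ x) Θ θhat →
          θhat ∈ Metric.closedBall θ₀ (r / 2) →
          θinit ∈ Θ →
          empLoss ρ x θinit - empLoss ρ x θhat ≤ r ^ 2 / 4 * τ₁ →
          -- the sample size and the number of iterations
          c₁ p r B * (√(K * Real.log (K / ξ)) / μ) ≤ (n : ℝ) →
          c₂ M * Real.log n ≤ (K : ℝ) →
          IsGaussianNoise P K Z →
          1 - ξ ≤ P.real {ω |
            ‖ngd Ψ η B μ K θinit (fun k => Z k ω) x K - θhat‖ ≤
              C * (B * √(K : ℝ) * (√(p : ℝ) + √(2 * Real.log (K / ξ))) / (μ * n))}) := by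
  refine ⟨?_, ?_⟩
  · intro m p n K 𝒳 Ψ η B μ θinit Ω _ P _ Z hn hK hη hB hμ hΨ hΨB hZ
    exact hZ.isGDP_ngd hn hK hη hB hμ hΨ hΨB
  · intro τ₁ τ₂ η hτ₁ hτ₂ hη hητ
    have hητ' : τ₂ * η ≤ 1 / 2 := by
      have h1 : η ≤ 1 / 2 * (1 / τ₂) := hητ.trans (by gcongr; exact min_le_left _ _)
      rw [mul_one_div, le_div_iff₀ hτ₂] at h1
      linarith
    have hκ : 0 < 1 - Real.exp (-(η * τ₁)) := by
      rw [sub_pos, Real.exp_lt_one_iff, neg_lt_zero]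
      positivity
    have hlog2 : 0 < Real.log 2 := Real.log_pos one_lt_two
    -- In `C` the first term sums the noise and the second bounds the optimization error. The
    -- absolute values and the `+ 1` in `c₁` make it positive for all real `r` and `B`.
    refine ⟨2 * η / (1 - Real.exp (-(η * τ₁))) + 1 / (2 * τ₁),
      fun p r B => 4 * η * |B| * (√(2 * p) + √2) / ((1 - Real.exp (-(η * τ₁))) * |r|) + 1,
      fun M => 2 / Real.log 2 + (1 + |Real.log M| / Real.log 2) / (η * τ₁),
      by positivity, fun p r B => by positivity, fun M => by positivity, ?_⟩
    intro m p n K 𝒳 Θ ρ Ψ B μ M ξ r θ₀ θhat θinit x Ω _ P _ Z hn _ hB hμ hμM hξ0 hξ1 hr _ hΨ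
      hconv hball hsc hsm hmin hθhat hinit hexc hnK hKn hZ
    exact ngd_convergence hτ₁ hτ₂ hη hητ' hn hB hμ hμM hξ0 hξ1 hr hΨ hconv hball hsc hsm hmin
      hθhat hinit hexc hnK hKn hZ
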